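/- **Setting.** Let $\mathcal S,\mathcal A$ be measurable spaces with finite reference measures (that of $\mathcal A$ nonzero), $P(\cdot|s,a)$ a Markov transition kernel, $P_0$ an initial distribution, $\gamma\in[0,1)$. A policy $\pi(a|s)$ is a conditional density on $\mathcal A$. Let $r_\theta(s,a)$, $\theta\in\mathbb R^d$, be a reward that is bounded and measurable in $(s,a)$ for each $\theta$ and differentiable in $\theta$, and let $\bar\theta\in\mathbb R^d$, $\lambda>0$. Write $J_\theta(\pi)=E^\pi[\sum_t\gamma^t r_\theta(S_t,A_t)]$ and $H(\pi)=E^\pi[-\sum_t\gamma^t\log\pi(A_t|S_t)]$ with $S_0\sim P_0$. Let $V_\theta$ be the bounded measurable solution of $V_\theta(s)=\log\int_{\mathcal A} e^{Q_\theta(s,a)}da$, $Q_\theta(s,a)=r_\theta(s,a)+\gamma\int V_\theta(s')P(ds'|s,a)$, let $\pi_\theta=e^{Q_\theta-V_\theta}$, and put $$L_t(\theta;(s,a))=-\gamma^t\log\pi_\theta(a|s)+\tfrac{\lambda\gamma^t}{2}\|\theta-\bar\theta\|^2 .$$ **Algorithm (MERIT-IRL).** An expert with an arbitrary policy $\pi_E$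 produces a trajectory $(S_t^E,A_t^E)_{t\ge0}$ with $S_0^E\sim P_0$. Start with $\theta_0=\bar\theta$ and any policy $\pi_0$. At time $t$ put $\pi_{t+1}(a|s)\propto\exp Q^{\rm soft}_{\theta_t,\pi_t}(s,a)$, where $Q^{\rm soft}_{\theta,\pi}(s,a)=r_\theta(s,a)+\gamma\int V^{\rm soft}_{\theta,\pi}(s')P(ds'|s,a)$ and $V^{\rm soft}_{\theta,\pi}(s)=E^\pi[\sum_k\gamma^k(r_\theta(S_k,A_k)-\log\pi(A_k|S_k))\,|\,S_0=s]$. Roll out $\pi_{t+1}$ twice, afresh: $(s_i',a_i')_{i\ge0}$ from $s_0'=S_0^E$, and $(s_i'',a_i'')_{i\ge0}$ with $(s_i'',a_i'')=(S_i^E,A_i^E)$ for $i\le t$, continued with $\pi_{t+1}$ for $i>t$. Put $\theta_{t+1}=\theta_t-\alpha_tg_t$ with $$g_t=\sum_{i\ge0}\gamma^i\nabla_\theta r_{\theta_t}(s_i',a_i')-\sum_{i\ge0}\gamma^i\nabla_\theta r_{\theta_t}(s_i'',a_i'')+\tfrac{\lambda(1-\gamma^{t+1})}{1-\gamma}(\theta_t-\bar\theta),\qquad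 \alpha_t=\frac{(1-\gamma)(t+1)^{-1/2}}{\lambda}.$$ **Theorem.** Assume there are constants $\bar C_r,\tilde C_r>0$ with $|r_{\theta_1}(s,a)-r_{\theta_2}(s,a)|\le\bar C_r\|\theta_1-\theta_2\|$ and $\|\nabla_\theta r_{\theta_1}(s,a)-\nabla_\theta r_{\theta_2}(s,a)\|\le\tilde C_r\|\theta_1-\theta_2\|$ for all $\theta_1,\theta_2,s,a$; and constants $C_M>0$, $\rho\in(0,1)$ such that for every policy $\pi$ the induced state chain has a stationary distribution $\mu^\pi$ with $d_{\rm TV}(\mathbb P_t^\pi,\mu^\pi)\le C_M\rho^t$ for all $t\ge0$, where $\mathbb P^\pi_t$ is the law of $S_t$ when $S_0\sim P_0$. Then, for every $\theta$, $\pi_\theta$ maximizes $J_\theta+H$ over the policies of finite causal entropy; every $L_t(\cdot;(s,a))$ is differentiable; and for all $T\ge1$ the local regret is integrable and $$E\Bigl[\sum_{t=0}^{T-1}\Bigl\|\frac1{t+1}\sum_{i=0}^t\nabla L_i(\theta_t;(S_i^E,A_i^E))\Bigr\|^2\Bigr]\le\Bigl(D_1+\frac{8C_M\bar C_r^2(2-\gamma)^2}{(1-\rho\gamma^2)(1-\gamma)^2}\Bigr)(\log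 T+1)+D_2\sqrt T+D_3\sqrt T(\log T+1).$$ The expectation is over the (temporally correlated) expert trajectory and the rollouts, and $$D_1=\frac{8\bar C_r^2(2-\gamma)^2}{(1-\gamma)^4},\qquad D_3=\frac{2(1-\gamma)}{\lambda}\Bigl(\frac{32C_Q\bar C_r^2C_d}{(1-\gamma)^3}+\frac{8\bar C_r^2C_L}{(1-\gamma)^2}\Bigr),$$ $C_Q=\frac{\bar C_r}{1-\gamma}$, $C_L=\frac{2\tilde C_r}{1-\gamma}+\frac{4\bar C_r^3}{(1-\gamma)^4}+\lambda$, $C_d$ is the product of the total reference measures of $\mathcal S$ and $\mathcal A$, and $D_2$ is an arbitrary positive number. -/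

import Mathlib

open MeasureTheory ProbabilityTheory Filter

namespace MeritIRL

noncomputable section

/-- The data of a discounted Markov decision process: measurable state space `S` and action
space `A` with finite reference measures (`volS`, `volA`: Lebesgue measure on bounded regions,
or counting measure on finite sets), the initial distribution `P0`, the transition kernel `P`
and the discount factor `γ ∈ [0, 1)`. -/
structure MDP (S A : Type*) [MeasurableSpace S] [MeasurableSpace A] where
  volS : Measure S
  volA : Measure A
  volS_finite : IsFiniteMeasure volS
  volA_finite : IsFiniteMeasure volA
  volA_ne_zero : volA ≠ 0
  P0 : Measure S
  P0_prob : IsProbabilityMeasure P0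
  P : Kernel (S × A) S
  P_markov : IsMarkovKernel P
  γ : ℝ
  γ_nonneg : 0 ≤ γ
  γ_lt_one : γ < 1

attribute [instance] MDP.volS_finite MDP.volA_finite MDP.P0_prob MDP.P_markov

variable {S A : Type*} [MeasurableSpace S] [MeasurableSpace A]

/-- A stationary stochastic policy, given by its density `π(a|s)` with respect to `volA`. -/
structure Policy (M : MDP S A) where
  density : S → A → ℝ
  measurable : Measurable (Function.uncurry density)
  nonneg : ∀ s a, 0 ≤ density s a
  integral_eq_one : ∀ s, ∫ a, density s a ∂M.volA = 1

/-! ### State and state-action distributions -/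

/-- The state-action distribution `ν(ds) π(a|s) da`. -/
def saLaw (M : MDP S A) (ν : Measure S) (π : S → A → ℝ) : Measure (S × A) :=
  (ν.prod M.volA).withDensity (fun x => ENNReal.ofReal (π x.1 x.2))

/-- The distribution of the state at time `t` when the initial state is drawn from `ν`
and the actions from the policy density `π`. -/
def stateLaw (M : MDP S A) (ν : Measure S) (π : S → A → ℝ) : ℕ → Measure S
  | 0 => ν
  | t + 1 => (saLaw M (stateLaw M ν π t) π).bind M.P

/-- Total variation distance `(1/2) ∫ |p - q|`, where `p`, `q` are the densities with respect
to the dominating measure `μ + ν` (the value does not depend on the dominating measure). -/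
def tvDist (μ ν : Measure S) : ℝ :=
  (1 / 2) * ∫ s, |(μ.rnDeriv (μ + ν) s).toReal - (ν.rnDeriv (μ + ν) s).toReal| ∂(μ + ν)

/-- Uniform geometric ergodicity over policies: the chain induced by any policy has a
stationary distribution `μ^π`, and the time-`t` state distribution converges to it in total
variation at the rate `C ρ ^ t`. -/
def Ergodic (M : MDP S A) (C ρ : ℝ) : Prop :=
  ∀ π : Policy M, ∃ μπ : Measure S, IsProbabilityMeasure μπ ∧
    stateLaw M μπ π.density 1 = μπ ∧
    ∀ t : ℕ, tvDist (stateLaw M M.P0 π.density t) μπ ≤ C * ρ ^ t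

/-! ### Entropy-regularized cumulative reward -/

/-- Cumulative reward `J(π) = E^π [∑ γ^t r(S_t, A_t)]`, with `S_0 ∼ P0`. -/
def cumReward (M : MDP S A) (r : S → A → ℝ) (π : S → A → ℝ) : ℝ :=
  ∑' t : ℕ, M.γ ^ t * ∫ x, r x.1 x.2 ∂(saLaw M (stateLaw M M.P0 π t) π)

/-- Causal entropy `H(π) = E^π [-∑ γ^t log π(A_t|S_t)]`, with `S_0 ∼ P0`. -/
def causalEntropy (M : MDP S A) (π : S → A → ℝ) : ℝ :=
  ∑' t : ℕ, M.γ ^ t * ∫ x, -Real.log (π x.1 x.2) ∂(saLaw M (stateLaw M M.P0 π t) π)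

/-- The causal entropy of `π` is a well-defined real number. (For finite `volA` the causal
entropy is bounded above, so for all other policies it is `-∞`.) -/
def FiniteEntropy (M : MDP S A) (π : S → A → ℝ) : Prop :=
  (∀ t : ℕ, Integrable (fun x => Real.log (π x.1 x.2)) (saLaw M (stateLaw M M.P0 π t) π)) ∧
  Summable (fun t : ℕ =>
    M.γ ^ t * ∫ x, |Real.log (π x.1 x.2)| ∂(saLaw M (stateLaw M M.P0 π t) π))

/-- `p` is (the density of) a policy that maximizes `J + H`. -/
def IsSoftOptimal (M : MDP S A) (r : S → A → ℝ) (p : S → A → ℝ) : Prop :=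
  ∃ π : Policy M, π.density = p ∧ FiniteEntropy M p ∧
    ∀ π' : Policy M, FiniteEntropy M π'.density →
      cumReward M r π'.density + causalEntropy M π'.density
        ≤ cumReward M r p + causalEntropy M p

/-! ### Soft value functions -/

/-- Soft value function of a policy, started at the state `s`. -/
def softV (M : MDP S A) (r : S → A → ℝ) (π : S → A → ℝ) (s : S) : ℝ :=
  ∑' t : ℕ, M.γ ^ t *
    ∫ x, (r x.1 x.2 - Real.log (π x.1 x.2)) ∂(saLaw M (stateLaw M (Measure.dirac s) π t) π)

/-- One-step look-ahead `r(s,a) + γ ∫ V(s') P(ds'|s,a)`. -/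
def lookahead (M : MDP S A) (r : S → A → ℝ) (V : S → ℝ) (s : S) (a : A) : ℝ :=
  r s a + M.γ * ∫ s', V s' ∂(M.P (s, a))

/-- Soft Q-function of a policy. -/
def softQ (M : MDP S A) (r : S → A → ℝ) (π : S → A → ℝ) (s : S) (a : A) : ℝ :=
  lookahead M r (softV M r π) s a

/-- The policy proportional to `exp Q`. -/
def softmax (M : MDP S A) (Q : S → A → ℝ) (s : S) (a : A) : ℝ :=
  Real.exp (Q s a) / ∫ a', Real.exp (Q s a') ∂M.volA

/-- `V` is a bounded measurable solution of the soft Bellman equation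
`V(s) = log ∫ exp (r(s,a) + γ ∫ V(s') P(ds'|s,a)) da`. -/
def IsSoftBellman (M : MDP S A) (r : S → A → ℝ) (V : S → ℝ) : Prop :=
  Measurable V ∧ (∃ K : ℝ, ∀ s, |V s| ≤ K) ∧
    ∀ s, V s = Real.log (∫ a, Real.exp (lookahead M r V s a) ∂M.volA)

open Classical in
/-- The optimal soft value function: the bounded measurable solution of the soft Bellman
equation. (For bounded measurable `r` it exists and is unique, the equation being a
`γ`-contraction.) -/
def optV (M : MDP S A) (r : S → A → ℝ) : S → ℝ :=
  if h : ∃ V : S → ℝ, IsSoftBellman M r V then h.choose else 0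

/-- The optimal soft Q-function. -/
def optQ (M : MDP S A) (r : S → A → ℝ) (s : S) (a : A) : ℝ :=
  lookahead M r (optV M r) s a

/-- The soft Bellman policy `exp Q(s,a) / exp V(s)`. -/
def optPolicy (M : MDP S A) (r : S → A → ℝ) (s : S) (a : A) : ℝ :=
  Real.exp (optQ M r s a) / Real.exp (optV M r s)

/-! ### Parametric rewards, loss functions, local regret -/

/-- The space of reward parameters. -/
abbrev Param (d : ℕ) : Type := EuclideanSpace ℝ (Fin d)

variable {d : ℕ}

/-- The parametric reward is (for every parameter) a bounded measurable function of the
state-action pair, and it is Lipschitz and smooth in the parameter, uniformly in `(s, a)`. -/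
structure RewardAssumption (r : Param d → S → A → ℝ) (C₁ C₂ : ℝ) : Prop where
  measurable : ∀ θ, Measurable (Function.uncurry (r θ))
  bounded : ∀ θ, ∃ K : ℝ, ∀ s a, |r θ s a| ≤ K
  differentiable : ∀ s a, Differentiable ℝ (fun θ => r θ s a)
  lipschitz : ∀ θ₁ θ₂ s a, |r θ₁ s a - r θ₂ s a| ≤ C₁ * ‖θ₁ - θ₂‖
  smooth : ∀ θ₁ θ₂ s a,
    ‖gradient (fun θ => r θ s a) θ₁ - gradient (fun θ => r θ s a) θ₂‖ ≤ C₂ * ‖θ₁ - θ₂‖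

/-- The loss `L_t(θ; (s, a)) = -γ^t log π_θ(a|s) + (lam γ^t / 2) ‖θ - θbar‖²`. -/
def loss (M : MDP S A) (r : Param d → S → A → ℝ) (lam : ℝ) (θbar : Param d)
    (t : ℕ) (x : S × A) (θ : Param d) : ℝ :=
  -M.γ ^ t * Real.log (optPolicy M (r θ) x.1 x.2) + lam * M.γ ^ t / 2 * ‖θ - θbar‖ ^ 2

/-- Total local regret over the horizon `T` of the parameters `θ 0, θ 1, …` on the stream
of state-action pairs `e 0, e 1, …`. -/
def localRegret (M : MDP S A) (r : Param d → S → A → ℝ) (lam : ℝ) (θbar : Param d)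
    (e : ℕ → S × A) (θ : ℕ → Param d) (T : ℕ) : ℝ :=
  ∑ t ∈ Finset.range T,
    ‖(1 / ((t : ℝ) + 1)) •
      ∑ i ∈ Finset.range (t + 1), gradient (loss M r lam θbar i (e i)) (θ t)‖ ^ 2

/-! ### The algorithm -/

/-- Step size `α_t = (1 - γ) (t + 1)^(-1/2) / lam`. -/
def stepSize (M : MDP S A) (lam : ℝ) (t : ℕ) : ℝ :=
  (1 - M.γ) * ((t : ℝ) + 1) ^ (-(1 / 2) : ℝ) / lam

/-- The gradient estimate `g_t` at the parameter `θ`, from the rollout `x₁` started at the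
initial expert state and the rollout `x₂` that completes the expert prefix. -/
def gradEst (M : MDP S A) (r : Param d → S → A → ℝ) (lam : ℝ) (θbar : Param d)
    (t : ℕ) (x₁ x₂ : ℕ → S × A) (θ : Param d) : Param d :=
  (∑' i : ℕ, M.γ ^ i • gradient (fun θ' => r θ' (x₁ i).1 (x₁ i).2) θ)
    - (∑' i : ℕ, M.γ ^ i • gradient (fun θ' => r θ' (x₂ i).1 (x₂ i).2) θ)
    + (lam * (1 - M.γ ^ (t + 1)) / (1 - M.γ)) • (θ - θbar)

/-- The reward parameters `θ_t`, where `x₁ t`, `x₂ t` are the two rollouts at time `t`. -/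
def thetaSeq (M : MDP S A) (r : Param d → S → A → ℝ) (lam : ℝ) (θbar : Param d)
    (x₁ x₂ : ℕ → ℕ → S × A) : ℕ → Param d
  | 0 => θbar
  | t + 1 => thetaSeq M r lam θbar x₁ x₂ t - stepSize M lam t •
      gradEst M r lam θbar t (x₁ t) (x₂ t) (thetaSeq M r lam θbar x₁ x₂ t)

/-- The policies `π_t`: `π_{t+1}(a|s) ∝ exp (softQ_{θ_t, π_t}(s, a))`. -/
def policySeq (M : MDP S A) (r : Param d → S → A → ℝ) (lam : ℝ) (θbar : Param d)
    (π₀ : S → A → ℝ) (x₁ x₂ : ℕ → ℕ → S × A) : ℕ → S → A → ℝ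
  | 0 => π₀
  | t + 1 => softmax M
      (softQ M (r (thetaSeq M r lam θbar x₁ x₂ t)) (policySeq M r lam θbar π₀ x₁ x₂ t))

section RunDefs

variable {Ω : Type*} [mΩ : MeasurableSpace Ω]

/-- The σ-algebra generated by a state-action trajectory before time `k`. -/
abbrev past (X : ℕ → Ω → S × A) (k : ℕ) : MeasurableSpace Ω :=
  ⨆ j : Fin k, MeasurableSpace.comap (X j) inferInstance

/-- The σ-algebra generated by a whole state-action trajectory. -/
abbrev whole (X : ℕ → Ω → S × A) : MeasurableSpace Ω :=
  ⨆ j : ℕ, MeasurableSpace.comap (X j) inferInstance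

/-- Given `F`, the trajectory before time `k` and the state at time `k`, the action at time
`k` is drawn from the (possibly random) policy density `π`. -/
def ActionStep (M : MDP S A) (μ : Measure Ω) (F : MeasurableSpace Ω)
    (π : Ω → S → A → ℝ) (X : ℕ → Ω → S × A) (k : ℕ) : Prop :=
  ∀ B : Set A, MeasurableSet B →
    μ[Set.indicator {ω | (X k ω).2 ∈ B} (fun _ => (1 : ℝ)) |
      F ⊔ past X k ⊔ MeasurableSpace.comap (fun ω => (X k ω).1) inferInstance]
      =ᵐ[μ] fun ω => ∫ a in B, π ω (X k ω).1 a ∂M.volA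

/-- Given `F` and the trajectory up to time `k`, the state at time `k + 1` is drawn from the
transition kernel. -/
def StateStep (M : MDP S A) (μ : Measure Ω) (F : MeasurableSpace Ω)
    (X : ℕ → Ω → S × A) (k : ℕ) : Prop :=
  ∀ B : Set S, MeasurableSet B →
    μ[Set.indicator {ω | (X (k + 1) ω).1 ∈ B} (fun _ => (1 : ℝ)) | F ⊔ past X (k + 1)]
      =ᵐ[μ] fun ω => (M.P (X k ω)).real B

/-- What is known when the rollouts at time `t` are simulated: the expert trajectory `E` and
the rollouts `X₁ u`, `X₂ u` at the times `u < t`. (The rollouts are conditioned on the whole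
expert trajectory: given the observed prefix they do not depend on the expert's future.) -/
abbrev known (E : ℕ → Ω → S × A) (X₁ X₂ : ℕ → ℕ → Ω → S × A) (t : ℕ) : MeasurableSpace Ω :=
  whole E ⊔ ⨆ u : Fin t, (whole (X₁ u) ⊔ whole (X₂ u))

/-- A run of the algorithm: `E` is the trajectory of the expert with policy `πE`, and at each
time `t` the policy `π_{t+1}` is rolled out twice, giving `X₁ t` (started at the initial expert
state) and `X₂ t` (which follows the expert up to time `t` and continues with `π_{t+1}`). -/
structure IsRun (M : MDP S A) (r : Param d → S → A → ℝ) (lam : ℝ) (θbar : Param d)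
    (πE π₀ : Policy M) (μ : Measure Ω)
    (E : ℕ → Ω → S × A) (X₁ X₂ : ℕ → ℕ → Ω → S × A) : Prop where
  measurable_expert : ∀ i, Measurable (E i)
  measurable_rollout₁ : ∀ t i, Measurable (X₁ t i)
  measurable_rollout₂ : ∀ t i, Measurable (X₂ t i)
  expert_init : μ.map (fun ω => (E 0 ω).1) = M.P0
  expert_action : ∀ k, ActionStep M μ ⊥ (fun _ => πE.density) E k
  expert_state : ∀ k, StateStep M μ ⊥ E k
  rollout₁_init : ∀ t ω, (X₁ t 0 ω).1 = (E 0 ω).1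
  rollout₁_action : ∀ t k, ActionStep M μ (known E X₁ X₂ t)
    (fun ω => policySeq M r lam θbar π₀.density (fun u i => X₁ u i ω) (fun u i => X₂ u i ω) (t + 1))
    (X₁ t) k
  rollout₁_state : ∀ t k, StateStep M μ (known E X₁ X₂ t) (X₁ t) k
  rollout₂_prefix : ∀ t i ω, i ≤ t → X₂ t i ω = E i ω
  rollout₂_state : ∀ t k, t ≤ k → StateStep M μ (known E X₁ X₂ t ⊔ whole (X₁ t)) (X₂ t) k
  rollout₂_action : ∀ t k, t < k → ActionStep M μ (known E X₁ X₂ t ⊔ whole (X₁ t))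
    (fun ω => policySeq M r lam θbar π₀.density (fun u i => X₁ u i ω) (fun u i => X₂ u i ω) (t + 1))
    (X₂ t) k

end RunDefs

/-! ### The constants of the bound -/

/-- `D₁ = 8 C₁² (2 - γ)² / (1 - γ)⁴`. -/
def constD₁ (γ C₁ : ℝ) : ℝ := 8 * C₁ ^ 2 * (2 - γ) ^ 2 / (1 - γ) ^ 4

/-- `C_Q = C₁ / (1 - γ)`. -/
def constQ (γ C₁ : ℝ) : ℝ := C₁ / (1 - γ)

/-- `C_L = 2 C₂ / (1 - γ) + 4 C₁³ / (1 - γ)⁴ + lam`. -/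
def constL (γ C₁ C₂ lam : ℝ) : ℝ := 2 * C₂ / (1 - γ) + 4 * C₁ ^ 3 / (1 - γ) ^ 4 + lam

/-- `C_d`, the product of the volumes of the state space and the action space. -/
def constd (M : MDP S A) : ℝ := M.volS.real Set.univ * M.volA.real Set.univ

/-- `D₃ = (2 (1 - γ) / lam) (32 C_Q C₁² C_d / (1 - γ)³ + 8 C₁² C_L / (1 - γ)²)`. -/
def constD₃ (M : MDP S A) (C₁ C₂ lam : ℝ) : ℝ :=
  2 * (1 - M.γ) / lam *
    (32 * constQ M.γ C₁ * C₁ ^ 2 * constd M / (1 - M.γ) ^ 3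
      + 8 * C₁ ^ 2 * constL M.γ C₁ C₂ lam / (1 - M.γ) ^ 2)

end

end MeritIRL

/-!
The local regret is bounded on every single trajectory, so that its mean needs only measurability
and boundedness.

The soft Bellman operator is a `γ`-contraction, hence `V_θ` and `Q_θ` are Lipschitz in `θ` with
constant `C₁ / (1 - γ)`, and `∇ log π_θ = ∇Q_θ - ∇V_θ` has norm at most `2 C₁ / (1 - γ)`
(`norm_gradient_log_optPolicy_le`). The regularizer pulls the iterates towards `θbar`: its
gradient times the step size is at most `‖θ_t - θbar‖`, and the rest of the update is bounded, so
that `‖θ_t - θbar‖ ≤ 2 C₁ / (lam (1 - γ))` for all `t` (`norm_thetaSeq_sub_le`). As the loss at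
time `i` carries the factor `γ^i`, the sum of the gradients of the first `t + 1` losses at `θ_t` has
norm at most `4 C₁ / (1 - γ)²`, and half of this for `t = 0`, uniformly in `t`. Divided by `t + 1`
and squared, it is at most `D₁ / (t + 1)` (`localRegret_summand_le`), and the harmonic sum gives
`D₁ (log T + 1)`. The other terms of the bound are nonnegative.

Differentiability of `V_θ` in `θ` comes from its candidate gradient, the bounded solution `G` of the
linear Bellman equation `G = E_π_θ [∇r_θ + γ P G]`: by the second-order expansion of the
log-partition function, the remainder `V_θ' - V_θ - ⟨G, θ' - θ⟩` is at most `γ` times its own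
supremum plus `O(‖θ' - θ‖²)` (`exists_hasGradientAt_optV`). Joint measurability of the gradients in
the state-action pair and the parameter, and with it integrability of the regret, follows from
difference quotients (`measurable_gradient_uncurry`).

Optimality of `π_θ` is the identity `J(π) + H(π) = E V_θ(S_0) - ∑ γ^t E KL(π ‖ π_θ)(S_t)`, which is
a telescoping sum (`cumReward_add_causalEntropy`), with Gibbs' inequality
(`integral_log_sub_log_nonpos`).
-/

namespace MeritIRL

noncomputable section

/-! ### Contractions on bounded measurable functions -/

/-- A bounded measurable function; these are the functions on which the Bellman operators act. -/
def BoundedMeasurable {α F : Type*} [MeasurableSpace α] [NormedAddCommGroup F]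
    [MeasurableSpace F] (f : α → F) : Prop :=
  Measurable f ∧ ∃ K : ℝ, ∀ x, ‖f x‖ ≤ K

/-- Banach's fixed point theorem for a `γ`-contraction of the bounded measurable functions with
the supremum norm. -/
theorem exists_fixedPoint {α F : Type*} [MeasurableSpace α] [NormedAddCommGroup F]
    [CompleteSpace F] [MeasurableSpace F] [BorelSpace F] {γ : ℝ} (hγ0 : 0 ≤ γ) (hγ1 : γ < 1)
    (Φ : (α → F) → α → F) (hΦ : ∀ f, BoundedMeasurable f → BoundedMeasurable (Φ f))
    (hcontr : ∀ f g, BoundedMeasurable f → BoundedMeasurable g → ∀ c : ℝ,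
      (∀ x, ‖f x - g x‖ ≤ c) → ∀ x, ‖Φ f x - Φ g x‖ ≤ γ * c) :
    ∃ f, BoundedMeasurable f ∧ ∀ x, f x = Φ f x := by
  -- Picard iteration from `0`
  set u : ℕ → α → F := fun n => Φ^[n] 0 with hu
  have hsucc : ∀ n, u (n + 1) = Φ (u n) := fun n => Function.iterate_succ_apply' Φ n 0
  have hbm : ∀ n, BoundedMeasurable (u n) := by
    intro n
    induction n with
    | zero => exact ⟨measurable_const, 0, fun x => by simp [hu]⟩
    | succ n ih => rw [hsucc]; exact hΦ _ ih
  obtain ⟨K, hK⟩ := (hbm 1).2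
  have hstep : ∀ n x, dist (u n x) (u (n + 1) x) ≤ K * γ ^ n := by
    intro n
    induction n with
    | zero => intro x; simpa [hu, dist_eq_norm] using hK x
    | succ n ih =>
      intro x
      rw [hsucc, hsucc (n + 1), dist_eq_norm]
      refine (hcontr _ _ (hbm n) (hbm (n + 1)) (K * γ ^ n)
        (fun y => by rw [← dist_eq_norm]; exact ih y) x).trans_eq (by ring)
  choose f hf using fun x => cauchySeq_tendsto_of_complete
    (cauchySeq_of_le_geometric γ K hγ1 fun n => hstep n x)
  have hdist : ∀ n x, ‖u n x - f x‖ ≤ K * γ ^ n / (1 - γ) := fun n x => by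
    rw [← dist_eq_norm]
    exact dist_le_of_le_geometric_of_tendsto γ K hγ1 (fun n => hstep n x) (hf x) n
  have hfbm : BoundedMeasurable f := by
    refine ⟨measurable_of_tendsto_metrizable (fun n => (hbm n).1) (tendsto_pi_nhds.2 hf),
      K / (1 - γ), fun x => ?_⟩
    simpa [hu] using hdist 0 x
  refine ⟨f, hfbm, fun x => ?_⟩
  have h1 : Tendsto (fun n => u (n + 1) x) atTop (nhds (f x)) :=
    (hf x).comp (tendsto_add_atTop_nat 1)
  have hz : Tendsto (fun n : ℕ => γ * (K * γ ^ n / (1 - γ))) atTop (nhds 0) := by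
    simpa using (((tendsto_pow_atTop_nhds_zero_of_lt_one hγ0 hγ1).const_mul K).div_const
      (1 - γ)).const_mul γ
  have h2 : Tendsto (fun n => u (n + 1) x) atTop (nhds (Φ f x)) := by
    refine tendsto_iff_norm_sub_tendsto_zero.2
      (squeeze_zero (fun n => norm_nonneg _) (fun n => ?_) hz)
    rw [hsucc]
    exact hcontr _ _ (hbm n) hfbm _ (hdist n) x
  exact tendsto_nhds_unique h1 h2

/-- A bounded function whose upper bounds `c` improve to `ε + γ c` is at most `ε / (1 - γ)`. -/
theorem le_div_of_forall_le_add_mul {α : Type*} {γ ε : ℝ} (hγ1 : γ < 1) (u : α → ℝ)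
    (hbdd : ∃ K, ∀ x, u x ≤ K)
    (h : ∀ c, (∀ x, u x ≤ c) → ∀ x, u x ≤ ε + γ * c) (x : α) : u x ≤ ε / (1 - γ) := by
  have : Nonempty α := ⟨x⟩
  obtain ⟨K, hK⟩ := hbdd
  have hB : BddAbove (Set.range u) := ⟨K, by rintro _ ⟨y, rfl⟩; exact hK y⟩
  have h1 : ⨆ y, u y ≤ ε + γ * ⨆ y, u y := ciSup_le (h _ fun y => le_ciSup hB y)
  refine (le_ciSup hB x).trans ?_
  rw [le_div_iff₀ (by linarith)]
  linarith

/-! ### The log-partition function -/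

section LogPartition

variable {A : Type*} [MeasurableSpace A] {m : Measure A} [IsFiniteMeasure m]

theorem integrable_exp {q : A → ℝ} (hq : BoundedMeasurable q) :
    Integrable (fun a => Real.exp (q a)) m := by
  obtain ⟨K, hK⟩ := hq.2
  refine Integrable.of_bound (Real.measurable_exp.comp hq.1).aestronglyMeasurable (Real.exp K)
    (Eventually.of_forall fun a => ?_)
  rw [Real.norm_eq_abs, Real.abs_exp]
  exact Real.exp_le_exp.2 ((le_abs_self _).trans (hK a))

theorem integral_exp_pos_of_boundedMeasurable [NeZero m] {q : A → ℝ} (hq : BoundedMeasurable q) :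
    0 < ∫ a, Real.exp (q a) ∂m := integral_exp_pos (integrable_exp hq)

theorem logPartition_le [NeZero m] {q q' : A → ℝ} (hq : BoundedMeasurable q)
    (hq' : BoundedMeasurable q') {c : ℝ} (h : ∀ a, q' a ≤ q a + c) :
    Real.log (∫ a, Real.exp (q' a) ∂m) ≤ Real.log (∫ a, Real.exp (q a) ∂m) + c := by
  rw [← Real.log_exp c,
    ← Real.log_mul (integral_exp_pos_of_boundedMeasurable hq).ne' (Real.exp_pos _).ne']
  refine Real.log_le_log (integral_exp_pos_of_boundedMeasurable hq') ?_
  rw [← integral_mul_const]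
  refine integral_mono (integrable_exp hq') ((integrable_exp hq).mul_const _) fun a => ?_
  simp only
  rw [← Real.exp_add]
  exact Real.exp_le_exp.2 (h a)

theorem abs_logPartition_sub_le [NeZero m] {q q' : A → ℝ} (hq : BoundedMeasurable q)
    (hq' : BoundedMeasurable q') {c : ℝ} (h : ∀ a, |q' a - q a| ≤ c) :
    |Real.log (∫ a, Real.exp (q' a) ∂m) - Real.log (∫ a, Real.exp (q a) ∂m)| ≤ c := by
  rw [abs_le]
  constructor
  · linarith [logPartition_le (m := m) hq' hq (c := c) fun a => by linarith [(abs_le.1 (h a)).1]]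
  · linarith [logPartition_le (m := m) hq hq' (c := c) fun a => by linarith [(abs_le.1 (h a)).2]]

/-- The derivative of the log-partition function is the mean under the Gibbs density, with a
quadratic remainder. -/
theorem abs_logPartition_sub_sub_integral_le [NeZero m] {q q' : A → ℝ} (hq : BoundedMeasurable q)
    (hq' : BoundedMeasurable q') {c V : ℝ} (hV : V = Real.log (∫ a, Real.exp (q a) ∂m))
    (hc : c ≤ 1) (h : ∀ a, |q' a - q a| ≤ c) :
    |Real.log (∫ a, Real.exp (q' a) ∂m) - V
      - ∫ a, Real.exp (q a) / Real.exp V * (q' a - q a) ∂m| ≤ c ^ 2 := by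
  have hZ := integral_exp_pos_of_boundedMeasurable (m := m) hq
  have hZ' := integral_exp_pos_of_boundedMeasurable (m := m) hq'
  have heV : Real.exp V = ∫ a, Real.exp (q a) ∂m := by rw [hV, Real.exp_log hZ]
  set p : A → ℝ := fun a => Real.exp (q a) / Real.exp V with hp
  have hpi : Integrable p m := (integrable_exp hq).div_const _
  have hp0 : ∀ a, 0 ≤ p a := fun a => by positivity
  have hp1 : ∫ a, p a ∂m = 1 := by
    rw [hp, integral_div, heV, div_self hZ.ne']
  have hui : Integrable (fun a => p a * (q' a - q a)) m :=
    hpi.mul_bdd (hq'.1.sub hq.1).aestronglyMeasurable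
      (Eventually.of_forall fun a => by simpa using h a)
  have hpe : ∀ a, p a * Real.exp (q' a - q a) = Real.exp (q' a) / Real.exp V := fun a => by
    simp only [hp, Real.exp_sub]
    field_simp
  have hei : Integrable (fun a => p a * Real.exp (q' a - q a)) m := by
    simp_rw [hpe]; exact (integrable_exp hq').div_const _
  set μ := ∫ a, p a * (q' a - q a) ∂m with hμ
  have hL : Real.log (∫ a, Real.exp (q' a) ∂m) - V
      = Real.log (∫ a, p a * Real.exp (q' a - q a) ∂m) := by
    simp_rw [hpe]
    rw [integral_div, Real.log_div hZ'.ne' (Real.exp_pos _).ne', Real.log_exp]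
  have hEpos : 0 < ∫ a, p a * Real.exp (q' a - q a) ∂m := by
    simp_rw [hpe]; rw [integral_div]; positivity
  rw [hL, abs_le]
  constructor
  · -- Jensen's inequality, from `exp x ≥ exp μ * (1 + x - μ)`
    have : Real.exp μ ≤ ∫ a, p a * Real.exp (q' a - q a) ∂m := by
      have h1 : ∫ a, Real.exp μ * (p a * (1 - μ) + p a * (q' a - q a)) ∂m
          ≤ ∫ a, p a * Real.exp (q' a - q a) ∂m := by
        refine integral_mono (((hpi.mul_const _).add hui).const_mul _) hei fun a => ?_
        have h2 := Real.add_one_le_exp (q' a - q a - μ)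
        have h3 : Real.exp (q' a - q a) = Real.exp μ * Real.exp (q' a - q a - μ) := by
          rw [← Real.exp_add]; congr 1; ring
        simp only
        rw [h3]
        have h4 := mul_le_mul_of_nonneg_left h2 (mul_nonneg (hp0 a) (Real.exp_pos μ).le)
        linarith
      rw [integral_const_mul, integral_add (hpi.mul_const _) hui, integral_mul_const, hp1,
        ← hμ] at h1
      linarith
    have := Real.log_le_log (Real.exp_pos _) this
    rw [Real.log_exp] at this
    nlinarith [sq_nonneg c]
  · -- the upper bound uses `log y ≤ y - 1` and `exp x ≤ 1 + x + x ^ 2` for `|x| ≤ 1`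
    have h1 : ∫ a, p a * Real.exp (q' a - q a) ∂m
        ≤ ∫ a, (p a * (1 + c ^ 2) + p a * (q' a - q a)) ∂m := by
      refine integral_mono hei ((hpi.mul_const _).add hui) fun a => ?_
      have h2 := (abs_le.1 (Real.abs_exp_sub_one_sub_id_le ((h a).trans hc))).2
      have h3 : (q' a - q a) ^ 2 ≤ c ^ 2 := sq_le_sq' (abs_le.1 (h a)).1 (abs_le.1 (h a)).2
      simp only
      rw [← mul_add]
      exact mul_le_mul_of_nonneg_left (by linarith) (hp0 a)
    rw [integral_add (hpi.mul_const _) hui, integral_mul_const, hp1, ← hμ] at h1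
    have h5 := Real.log_le_sub_one_of_pos hEpos
    linarith

end LogPartition

/-! ### The soft Bellman equation -/

variable {S A : Type*} [MeasurableSpace S] [MeasurableSpace A] {d : ℕ}

instance (M : MDP S A) : NeZero M.volA := ⟨M.volA_ne_zero⟩

theorem norm_integral_le_of_norm_le_prob {α F : Type*} [MeasurableSpace α] [NormedAddCommGroup F]
    [NormedSpace ℝ F] {m : Measure α} [IsProbabilityMeasure m] {f : α → F} {c : ℝ}
    (h : ∀ x, ‖f x‖ ≤ c) : ‖∫ x, f x ∂m‖ ≤ c := by
  simpa using norm_integral_le_of_norm_le_const (μ := m) (Eventually.of_forall h)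

/-- An average with respect to a probability density is bounded by a bound of the function. -/
theorem norm_integral_smul_le {α F : Type*} [MeasurableSpace α] [NormedAddCommGroup F]
    [NormedSpace ℝ F] {m : Measure α} {p : α → ℝ} (hp0 : ∀ a, 0 ≤ p a)
    (hp1 : ∫ a, p a ∂m = 1) {f : α → F} {c : ℝ} (h : ∀ x, ‖f x‖ ≤ c) :
    ‖∫ a, p a • f a ∂m‖ ≤ c := by
  have hpi := integrable_of_integral_eq_one hp1
  refine (norm_integral_le_of_norm_le (hpi.mul_const c) (Eventually.of_forall fun a => ?_)).trans_eq
    (by rw [integral_mul_const, hp1, one_mul])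
  rw [norm_smul, Real.norm_of_nonneg (hp0 a)]
  exact mul_le_mul_of_nonneg_left (h a) (hp0 a)

theorem BoundedMeasurable.integrable {α F : Type*} [MeasurableSpace α] [NormedAddCommGroup F]
    [MeasurableSpace F] [BorelSpace F] [SecondCountableTopology F] {f : α → F}
    (hf : BoundedMeasurable f) (m : Measure α) [IsFiniteMeasure m] : Integrable f m := by
  obtain ⟨K, hK⟩ := hf.2
  exact Integrable.of_bound hf.1.aestronglyMeasurable K (Eventually.of_forall hK)

theorem BoundedMeasurable.integrable_smul {α F : Type*} [MeasurableSpace α]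
    [NormedAddCommGroup F] [NormedSpace ℝ F] [MeasurableSpace F] [BorelSpace F]
    [SecondCountableTopology F] {m : Measure α} {p : α → ℝ} (hp1 : ∫ a, p a ∂m = 1) {f : α → F}
    (hf : BoundedMeasurable f) : Integrable (fun a => p a • f a) m := by
  obtain ⟨K, hK⟩ := hf.2
  exact (integrable_of_integral_eq_one hp1).smul_bdd K hf.1.aestronglyMeasurable
    (Eventually.of_forall hK)

theorem BoundedMeasurable.comp_mk_left {F : Type*} [NormedAddCommGroup F] [MeasurableSpace F]
    {f : S × A → F} (hf : BoundedMeasurable f) (s : S) : BoundedMeasurable fun a => f (s, a) :=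
  ⟨hf.1.comp measurable_prodMk_left, hf.2.imp fun _ h a => h (s, a)⟩

theorem BoundedMeasurable.add_discounted (M : MDP S A) {F : Type*} [NormedAddCommGroup F]
    [NormedSpace ℝ F] [MeasurableSpace F] [BorelSpace F] [SecondCountableTopology F]
    {g : S × A → F} {G : S → F} (hg : BoundedMeasurable g) (hG : BoundedMeasurable G) :
    BoundedMeasurable fun x : S × A => g x + M.γ • ∫ s', G s' ∂(M.P x) := by
  obtain ⟨K, hK⟩ := hg.2
  obtain ⟨L, hL⟩ := hG.2
  refine ⟨hg.1.add ((StronglyMeasurable.integral_kernel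
    hG.1.stronglyMeasurable).measurable.const_smul _), K + M.γ * L, fun x => ?_⟩
  refine (norm_add_le _ _).trans (add_le_add (hK x) ?_)
  rw [norm_smul, Real.norm_of_nonneg M.γ_nonneg]
  exact mul_le_mul_of_nonneg_left (norm_integral_le_of_norm_le_prob hL) M.γ_nonneg

theorem boundedMeasurable_lookahead (M : MDP S A) {r : S → A → ℝ} {V : S → ℝ}
    (hr : BoundedMeasurable (Function.uncurry r)) (hV : BoundedMeasurable V) :
    BoundedMeasurable (Function.uncurry (lookahead M r V)) :=
  BoundedMeasurable.add_discounted M hr hV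

theorem abs_lookahead_sub_le (M : MDP S A) {r r' : S → A → ℝ} {V V' : S → ℝ} {c e : ℝ}
    (hV : BoundedMeasurable V) (hV' : BoundedMeasurable V')
    (hr : ∀ s a, |r' s a - r s a| ≤ c) (h : ∀ s, |V' s - V s| ≤ e) (s : S) (a : A) :
    |lookahead M r' V' s a - lookahead M r V s a| ≤ c + M.γ * e := by
  have h1 : lookahead M r' V' s a - lookahead M r V s a
      = (r' s a - r s a) + M.γ * ∫ s', (V' s' - V s') ∂(M.P (s, a)) := by
    rw [integral_sub (hV'.integrable _) (hV.integrable _)]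
    simp only [lookahead]; ring
  rw [h1]
  refine (abs_add_le _ _).trans (add_le_add (hr s a) ?_)
  rw [abs_mul, abs_of_nonneg M.γ_nonneg]
  exact mul_le_mul_of_nonneg_left (norm_integral_le_of_norm_le_prob (f := fun s' => V' s' - V s') h)
    M.γ_nonneg

/-- The soft Bellman operator is a `γ`-contraction, so its equation has a solution. -/
theorem optV_isSoftBellman (M : MDP S A) {r : S → A → ℝ}
    (hr : BoundedMeasurable (Function.uncurry r)) : IsSoftBellman M r (optV M r) := by
  suffices h : ∃ V, IsSoftBellman M r V by
    unfold optV
    rw [dif_pos h]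
    exact h.choose_spec
  obtain ⟨V, hV, hfix⟩ := exists_fixedPoint (α := S) M.γ_nonneg M.γ_lt_one
    (fun V s => Real.log (∫ a, Real.exp (lookahead M r V s a) ∂M.volA)) (by
      intro V hV
      have hQ := boundedMeasurable_lookahead M hr hV
      obtain ⟨K, hK⟩ := hQ.2
      refine ⟨Real.measurable_log.comp (StronglyMeasurable.integral_prod_right'
        (f := fun x : S × A => Real.exp (lookahead M r V x.1 x.2))
        (Real.measurable_exp.comp hQ.1).stronglyMeasurable).measurable,
        K + |Real.log (∫ _, Real.exp 0 ∂M.volA)|, fun s => ?_⟩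
      have h1 := abs_logPartition_sub_le (m := M.volA) (q := fun _ => 0)
        ⟨measurable_const, 0, by simp⟩ (hQ.comp_mk_left s) (c := K) fun a => by
          simpa using hK (s, a)
      refine (abs_sub_abs_le_abs_sub _ _).trans h1 |> fun h => ?_
      rw [Real.norm_eq_abs]
      simp only [Function.uncurry] at h
      linarith) (by
      intro V V' hV hV' c hc s
      have h1 := abs_logPartition_sub_le (m := M.volA)
        ((boundedMeasurable_lookahead M hr hV').comp_mk_left s)
        ((boundedMeasurable_lookahead M hr hV).comp_mk_left s) (c := 0 + M.γ * c) fun a =>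
          abs_lookahead_sub_le M (c := 0) hV' hV (by simp) hc s a
      rw [zero_add] at h1
      exact h1)
  exact ⟨V, hV.1, hV.2, hfix⟩

section Bellman

variable (M : MDP S A) {r : S → A → ℝ} (hr : BoundedMeasurable (Function.uncurry r))
include hr

theorem boundedMeasurable_optV : BoundedMeasurable (optV M r) :=
  ⟨(optV_isSoftBellman M hr).1, (optV_isSoftBellman M hr).2.1⟩

theorem boundedMeasurable_optQ : BoundedMeasurable (Function.uncurry (optQ M r)) :=
  boundedMeasurable_lookahead M hr (boundedMeasurable_optV M hr)

theorem optV_eq_log (s : S) : optV M r s = Real.log (∫ a, Real.exp (optQ M r s a) ∂M.volA) :=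
  (optV_isSoftBellman M hr).2.2 s

theorem measurable_optPolicy : Measurable (Function.uncurry (optPolicy M r)) :=
  (Real.measurable_exp.comp (boundedMeasurable_optQ M hr).1).div
    (Real.measurable_exp.comp ((boundedMeasurable_optV M hr).1.comp measurable_fst))

theorem integral_optPolicy (s : S) : ∫ a, optPolicy M r s a ∂M.volA = 1 := by
  have h := integral_exp_pos_of_boundedMeasurable (m := M.volA)
    ((boundedMeasurable_optQ M hr).comp_mk_left s)
  simp only [Function.uncurry] at h
  simp only [optPolicy]
  rw [integral_div, optV_eq_log M hr s, Real.exp_log h, div_self h.ne']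

end Bellman

theorem optPolicy_pos (M : MDP S A) (r : S → A → ℝ) (s : S) (a : A) : 0 < optPolicy M r s a := by
  unfold optPolicy; positivity

theorem log_optPolicy (M : MDP S A) (r : S → A → ℝ) (s : S) (a : A) :
    Real.log (optPolicy M r s a) = optQ M r s a - optV M r s := by
  rw [optPolicy, ← Real.exp_sub, Real.log_exp]

theorem abs_optV_sub_le (M : MDP S A) {r r' : S → A → ℝ}
    (hr : BoundedMeasurable (Function.uncurry r)) (hr' : BoundedMeasurable (Function.uncurry r'))
    {c : ℝ} (h : ∀ s a, |r' s a - r s a| ≤ c) (s : S) :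
    |optV M r' s - optV M r s| ≤ c / (1 - M.γ) := by
  have hV := boundedMeasurable_optV M hr
  have hV' := boundedMeasurable_optV M hr'
  obtain ⟨K, hK⟩ := hV.2
  obtain ⟨K', hK'⟩ := hV'.2
  refine le_div_of_forall_le_add_mul M.γ_lt_one (fun s => |optV M r' s - optV M r s|)
    ⟨K' + K, fun s => (norm_sub_le _ _).trans (add_le_add (hK' s) (hK s))⟩ (fun e he s => ?_) s
  rw [optV_eq_log M hr, optV_eq_log M hr']
  exact abs_logPartition_sub_le ((boundedMeasurable_optQ M hr).comp_mk_left s)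
    ((boundedMeasurable_optQ M hr').comp_mk_left s) fun a => abs_lookahead_sub_le M hV hV' h he s a

theorem abs_optQ_sub_le (M : MDP S A) {r r' : S → A → ℝ}
    (hr : BoundedMeasurable (Function.uncurry r)) (hr' : BoundedMeasurable (Function.uncurry r'))
    {c : ℝ} (h : ∀ s a, |r' s a - r s a| ≤ c) (s : S) (a : A) :
    |optQ M r' s a - optQ M r s a| ≤ c / (1 - M.γ) := by
  refine (abs_lookahead_sub_le M (boundedMeasurable_optV M hr) (boundedMeasurable_optV M hr') h
    (abs_optV_sub_le M hr hr' h) s a).trans_eq ?_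
  have : 1 - M.γ ≠ 0 := by linarith [M.γ_lt_one]
  field_simp
  ring

/-! ### Gradients in the parameter -/

/-- The coordinates of the gradient are limits of difference quotients of a jointly measurable
function. -/
theorem measurable_gradient_uncurry {X : Type*} [MeasurableSpace X] {f : X → Param d → ℝ}
    (hf : ∀ θ, Measurable fun x => f x θ) (hd : ∀ x, Differentiable ℝ (f x)) :
    Measurable fun p : X × Param d => gradient (f p.1) p.2 := by
  have hjoint : Measurable fun p : X × Param d => f p.1 p.2 :=
    (measurable_uncurry_of_continuous_of_measurable (u := fun θ x => f x θ)
      (fun x => (hd x).continuous) hf).comp measurable_swap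
  let b := EuclideanSpace.basisFun (Fin d) ℝ
  have hdir : ∀ i, Measurable fun p : X × Param d => fderiv ℝ (f p.1) p.2 (b i) := by
    intro i
    refine measurable_of_tendsto_metrizable (f := fun (n : ℕ) (p : X × Param d) =>
      (n : ℝ) • (f p.1 (p.2 + (n : ℝ)⁻¹ • b i) - f p.1 p.2)) (fun n => ?_) ?_
    · exact ((hjoint.comp (measurable_fst.prodMk (measurable_snd.add_const _))).sub
        hjoint).const_mul (n : ℝ)
    · refine tendsto_pi_nhds.2 fun p => (hd p.1 p.2).hasFDerivAt.lim (b i) ?_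
      simpa using tendsto_natCast_atTop_atTop (R := ℝ)
  have heq : (fun p : X × Param d => gradient (f p.1) p.2)
      = fun p => ∑ i, fderiv ℝ (f p.1) p.2 (b i) • b i := by
    funext p
    rw [← b.sum_repr' (gradient (f p.1) p.2)]
    refine Finset.sum_congr rfl fun i _ => ?_
    rw [← toDual_gradient, InnerProductSpace.toDual_apply_apply, real_inner_comm]
  rw [heq]
  exact Finset.measurable_sum _ fun i _ => (hdir i).smul_const _

theorem norm_gradient (f : Param d → ℝ) (θ : Param d) : ‖gradient f θ‖ = ‖fderiv ℝ f θ‖ := by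
  rw [← toDual_gradient, LinearIsometryEquiv.norm_map]

theorem norm_gradient_le_of_abs_sub_le {f : Param d → ℝ} {c : ℝ} (hc : 0 ≤ c)
    (h : ∀ θ₁ θ₂, |f θ₁ - f θ₂| ≤ c * ‖θ₁ - θ₂‖) (θ : Param d) : ‖gradient f θ‖ ≤ c := by
  rw [norm_gradient]
  exact norm_fderiv_le_of_lipschitz ℝ (C := ⟨c, hc⟩)
    (LipschitzWith.of_dist_le_mul fun x y => by rw [Real.dist_eq, dist_eq_norm]; exact h x y)

/-- Taylor's formula of first order for a function with a Lipschitz gradient. -/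
theorem abs_sub_sub_inner_gradient_le {f : Param d → ℝ} {c : ℝ} (hf : Differentiable ℝ f)
    (hc : 0 ≤ c) (h : ∀ θ₁ θ₂, ‖gradient f θ₁ - gradient f θ₂‖ ≤ c * ‖θ₁ - θ₂‖)
    (θ θ' : Param d) :
    |f θ' - f θ - inner ℝ (gradient f θ) (θ' - θ)| ≤ c * ‖θ' - θ‖ ^ 2 := by
  have h1 := Convex.norm_image_sub_le_of_norm_hasFDerivWithin_le' (𝕜 := ℝ) (f := f)
    (f' := fderiv ℝ f) (φ := fderiv ℝ f θ) (C := c * ‖θ' - θ‖)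
    (s := Metric.closedBall θ ‖θ' - θ‖) (x := θ) (y := θ')
    (fun x _ => (hf x).hasFDerivAt.hasFDerivWithinAt) (fun x hx => by
      rw [← toDual_gradient, ← toDual_gradient, ← map_sub, LinearIsometryEquiv.norm_map]
      refine (h x θ).trans (mul_le_mul_of_nonneg_left ?_ hc)
      rwa [← dist_eq_norm])
    (convex_closedBall _ _) (Metric.mem_closedBall_self (norm_nonneg _))
    (by rw [Metric.mem_closedBall, dist_eq_norm])
  rw [← toDual_gradient, InnerProductSpace.toDual_apply_apply] at h1
  refine h1.trans_eq (by ring)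

theorem hasGradientAt_of_quadratic_remainder {f : Param d → ℝ} {θ g : Param d} {C δ : ℝ}
    (hδ : 0 < δ) (h : ∀ θ', ‖θ' - θ‖ ≤ δ → |f θ' - f θ - inner ℝ g (θ' - θ)| ≤ C * ‖θ' - θ‖ ^ 2) :
    HasGradientAt f g θ := by
  rw [hasGradientAt_iff_isLittleO]
  have h1 : (fun θ' => f θ' - f θ - inner ℝ g (θ' - θ)) =O[nhds θ] fun θ' => ‖θ' - θ‖ ^ 2 := by
    refine Asymptotics.IsBigO.of_bound C ?_
    filter_upwards [Metric.closedBall_mem_nhds θ hδ] with θ' hθ'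
    rw [Metric.mem_closedBall, dist_eq_norm] at hθ'
    simpa using h θ' hθ'
  refine h1.trans_isLittleO ?_
  have h2 : (fun θ' : Param d => ‖θ' - θ‖ ^ 2) =o[nhds θ] fun θ' => ‖θ' - θ‖ ^ 1 := by
    refine (Asymptotics.isLittleO_pow_pow (𝕜 := ℝ) one_lt_two).comp_tendsto ?_
    have : Continuous fun θ' : Param d => ‖θ' - θ‖ := by fun_prop
    simpa using this.tendsto θ
  simpa using h2.trans_isBigO (by simpa using (Asymptotics.isBigO_refl _ _).norm_left)

section Reward

variable (M : MDP S A) {r : Param d → S → A → ℝ} {C₁ C₂ : ℝ} (hr : RewardAssumption r C₁ C₂)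
include hr

theorem RewardAssumption.boundedMeasurable (θ : Param d) :
    BoundedMeasurable (Function.uncurry (r θ)) :=
  ⟨hr.measurable θ, (hr.bounded θ).imp fun _ h x => h x.1 x.2⟩

theorem RewardAssumption.measurable_gradient :
    Measurable fun p : (S × A) × Param d => gradient (fun θ => r θ p.1.1 p.1.2) p.2 :=
  measurable_gradient_uncurry (f := fun (x : S × A) θ => r θ x.1 x.2) (fun θ => hr.measurable θ)
    fun x => hr.differentiable x.1 x.2

theorem RewardAssumption.norm_gradient_le (hC₁ : 0 ≤ C₁) (θ : Param d) (s : S) (a : A) :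
    ‖gradient (fun θ => r θ s a) θ‖ ≤ C₁ :=
  norm_gradient_le_of_abs_sub_le hC₁ (fun θ₁ θ₂ => hr.lipschitz θ₁ θ₂ s a) θ

/-- The gradient of the optimal soft value function solves the linear Bellman equation
`G(s) = ∫ π_θ(a|s) (∇r_θ(s,a) + γ ∫ G dP(·|s,a)) da`. -/
theorem exists_gradientBellman (hC₁ : 0 ≤ C₁) (θ : Param d) :
    ∃ G : S → Param d, BoundedMeasurable G ∧ ∀ s, G s = ∫ a, optPolicy M (r θ) s a •
      (gradient (fun θ => r θ s a) θ + M.γ • ∫ s', G s' ∂(M.P (s, a))) ∂M.volA := by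
  have hbm := hr.boundedMeasurable θ
  have hg : BoundedMeasurable fun x : S × A => gradient (fun θ => r θ x.1 x.2) θ :=
    ⟨hr.measurable_gradient.comp measurable_prodMk_right, C₁,
      fun x => hr.norm_gradient_le hC₁ θ x.1 x.2⟩
  have hp0 : ∀ s a, 0 ≤ optPolicy M (r θ) s a := fun s a => (optPolicy_pos M _ s a).le
  have hp1 := integral_optPolicy M hbm
  refine exists_fixedPoint (α := S) M.γ_nonneg M.γ_lt_one
    (fun G s => ∫ a, optPolicy M (r θ) s a •
      (gradient (fun θ => r θ s a) θ + M.γ • ∫ s', G s' ∂(M.P (s, a))) ∂M.volA) ?_ ?_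
  · intro G hG
    have hb := hg.add_discounted M hG
    obtain ⟨K, hK⟩ := hb.2
    refine ⟨(StronglyMeasurable.integral_prod_right' (f := fun x : S × A =>
      optPolicy M (r θ) x.1 x.2 • (gradient (fun θ => r θ x.1 x.2) θ + M.γ • ∫ s', G s' ∂(M.P x)))
      ((measurable_optPolicy M hbm).smul hb.1).stronglyMeasurable).measurable, K, fun s => ?_⟩
    exact norm_integral_smul_le (hp0 s) (hp1 s) fun a => hK (s, a)
  · intro G G' hG hG' c hc s
    have hint : ∀ {G : S → Param d}, BoundedMeasurable G → Integrable (fun a =>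
        optPolicy M (r θ) s a •
          (gradient (fun θ => r θ s a) θ + M.γ • ∫ s', G s' ∂(M.P (s, a)))) M.volA :=
      fun hG => ((hg.add_discounted M hG).comp_mk_left s).integrable_smul (hp1 s)
    rw [← integral_sub (hint hG) (hint hG')]
    simp_rw [← smul_sub, add_sub_add_left_eq_sub, ← smul_sub]
    refine norm_integral_smul_le (hp0 s) (hp1 s) fun a => ?_
    rw [norm_smul, Real.norm_of_nonneg M.γ_nonneg,
      ← integral_sub (hG.integrable _) (hG'.integrable _)]
    exact mul_le_mul_of_nonneg_left (norm_integral_le_of_norm_le_prob hc) M.γ_nonneg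

/-- The remainder `V_θ' - V_θ - ⟨G, θ' - θ⟩` is at most its own discounted average plus a
quadratic error, so it is quadratic in `θ' - θ`. -/
theorem exists_hasGradientAt_optV (hC₁ : 0 < C₁) (hC₂ : 0 ≤ C₂) (θ : Param d) :
    ∃ G : S → Param d, BoundedMeasurable G ∧
      ∀ s, HasGradientAt (fun θ => optV M (r θ) s) (G s) θ := by
  obtain ⟨G, hG, hfix⟩ := exists_gradientBellman M hr hC₁.le θ
  refine ⟨G, hG, fun s => ?_⟩
  have hγ : 0 < 1 - M.γ := by linarith [M.γ_lt_one]
  set L := C₁ / (1 - M.γ) with hL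
  have hLpos : 0 < L := by positivity
  refine hasGradientAt_of_quadratic_remainder (δ := 1 / L) (C := (L ^ 2 + C₂) / (1 - M.γ))
    (by positivity) fun θ' hθ' => ?_
  have hbm := hr.boundedMeasurable θ
  have hbm' := hr.boundedMeasurable θ'
  have hV := boundedMeasurable_optV M hbm
  have hV' := boundedMeasurable_optV M hbm'
  have hrd : ∀ s a, |r θ' s a - r θ s a| ≤ C₁ * ‖θ' - θ‖ := fun s a => hr.lipschitz θ' θ s a
  have hc : C₁ * ‖θ' - θ‖ / (1 - M.γ) = L * ‖θ' - θ‖ := by rw [hL]; ring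
  have hQd := abs_optQ_sub_le M hbm hbm' hrd
  rw [hc] at hQd
  have hp0 : ∀ s a, 0 ≤ optPolicy M (r θ) s a := fun s a => (optPolicy_pos M _ s a).le
  have hp1 := integral_optPolicy M hbm
  set h := θ' - θ with hh
  have hGh : BoundedMeasurable fun s => (inner ℝ (G s) h : ℝ) := by
    obtain ⟨K, hK⟩ := hG.2
    exact ⟨hG.1.inner_const, K * ‖h‖, fun s => (norm_inner_le_norm _ _).trans
      (mul_le_mul_of_nonneg_right (hK s) (norm_nonneg _))⟩
  set e : S → ℝ := fun s => optV M (r θ') s - optV M (r θ) s - inner ℝ (G s) h with he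
  obtain ⟨K, hK⟩ := hV.2
  obtain ⟨K', hK'⟩ := hV'.2
  obtain ⟨K'', hK''⟩ := hGh.2
  have hebm : BoundedMeasurable e := ⟨(hV'.1.sub hV.1).sub hGh.1, K' + K + K'', fun s =>
    (norm_sub_le _ _).trans (add_le_add ((norm_sub_le _ _).trans
      (add_le_add (hK' s) (hK s))) (hK'' s))⟩
  have key := le_div_of_forall_le_add_mul M.γ_lt_one (ε := (L ^ 2 + C₂) * ‖h‖ ^ 2)
    (fun s => |e s|) hebm.2 (fun c hce s => ?_) s
  · refine key.trans_eq (by ring)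
  -- the radius `1 / L` makes the change of `Q_θ` at most `1`, as the expansion requires
  have h1 := abs_logPartition_sub_sub_integral_le (m := M.volA)
    ((boundedMeasurable_optQ M hbm).comp_mk_left s) ((boundedMeasurable_optQ M hbm').comp_mk_left s)
    (optV_eq_log M hbm s) (c := L * ‖h‖) (by rwa [le_div_iff₀' hLpos] at hθ') (hQd s)
  have h2 : Real.log (∫ a, Real.exp (Function.uncurry (optQ M (r θ')) (s, a)) ∂M.volA)
      = optV M (r θ') s := (optV_eq_log M hbm' s).symm
  rw [h2] at h1
  -- the directional derivative at `s` is an average of one-step derivatives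
  have hgm : BoundedMeasurable fun x : S × A => gradient (fun θ => r θ x.1 x.2) θ :=
    ⟨hr.measurable_gradient.comp measurable_prodMk_right, C₁,
      fun x => hr.norm_gradient_le hC₁.le θ x.1 x.2⟩
  have hint1 : Integrable (fun a => optPolicy M (r θ) s a •
      (gradient (fun θ => r θ s a) θ + M.γ • ∫ s', G s' ∂(M.P (s, a)))) M.volA :=
    ((hgm.add_discounted M hG).comp_mk_left s).integrable_smul (hp1 s)
  have h3 : inner ℝ (G s) h = ∫ a, optPolicy M (r θ) s a •
      (inner ℝ (gradient (fun θ => r θ s a) θ) h + M.γ * ∫ s', inner ℝ (G s') h ∂(M.P (s, a)))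
        ∂M.volA := by
    rw [hfix s, real_inner_comm, ← integral_inner hint1]
    refine integral_congr_ae (Eventually.of_forall fun a => ?_)
    simp only
    rw [inner_smul_right, inner_add_right, inner_smul_right, ← integral_inner (hG.integrable _),
      smul_eq_mul, real_inner_comm]
    simp_rw [real_inner_comm]
  have hint2 : Integrable (fun a => optPolicy M (r θ) s a •
      (inner ℝ (gradient (fun θ => r θ s a) θ) h + M.γ * ∫ s', inner ℝ (G s') h ∂(M.P (s, a))))
        M.volA := by
    refine (hint1.const_inner h).congr (Eventually.of_forall fun a => ?_)
    simp only
    rw [inner_smul_right, inner_add_right, inner_smul_right, ← integral_inner (hG.integrable _),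
      smul_eq_mul, real_inner_comm]
    simp_rw [real_inner_comm]
  have hint3 : Integrable (fun a => optPolicy M (r θ) s a • (optQ M (r θ') s a - optQ M (r θ) s a))
      M.volA :=
    BoundedMeasurable.integrable_smul (hp1 s)
      ⟨((boundedMeasurable_optQ M hbm').comp_mk_left s).1.sub
      ((boundedMeasurable_optQ M hbm).comp_mk_left s).1, _, hQd s⟩
  -- the second-order error of the reward, plus the discounted average of `e` over the next state
  have h4 : |∫ a, optPolicy M (r θ) s a • (optQ M (r θ') s a - optQ M (r θ) s a) ∂M.volA
      - inner ℝ (G s) h| ≤ C₂ * ‖h‖ ^ 2 + M.γ * c := by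
    rw [h3, ← integral_sub hint3 hint2]
    simp_rw [← smul_sub]
    rw [← Real.norm_eq_abs]
    refine norm_integral_smul_le (hp0 s) (hp1 s) fun a => ?_
    have h5 : optQ M (r θ') s a - optQ M (r θ) s a - (inner ℝ (gradient (fun θ => r θ s a) θ) h
        + M.γ * ∫ s', inner ℝ (G s') h ∂(M.P (s, a)))
        = (r θ' s a - r θ s a - inner ℝ (gradient (fun θ => r θ s a) θ) h)
          + M.γ * ∫ s', e s' ∂(M.P (s, a)) := by
      rw [he, integral_sub (f := fun s' => optV M (r θ') s' - optV M (r θ) s')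
        ((hV'.integrable _).sub (hV.integrable _)) (hGh.integrable _),
        integral_sub (hV'.integrable _) (hV.integrable _)]
      simp only [optQ, lookahead]
      ring
    rw [h5, Real.norm_eq_abs]
    refine (abs_add_le _ _).trans (add_le_add (abs_sub_sub_inner_gradient_le
      (hr.differentiable s a) hC₂ (fun θ₁ θ₂ => hr.smooth θ₁ θ₂ s a) θ θ') ?_)
    rw [abs_mul, abs_of_nonneg M.γ_nonneg]
    exact mul_le_mul_of_nonneg_left (norm_integral_le_of_norm_le_prob (f := e) hce) M.γ_nonneg
  have h6 : e s = (optV M (r θ') s - optV M (r θ) s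
        - ∫ a, optPolicy M (r θ) s a • (optQ M (r θ') s a - optQ M (r θ) s a) ∂M.volA)
      + (∫ a, optPolicy M (r θ) s a • (optQ M (r θ') s a - optQ M (r θ) s a) ∂M.volA
        - inner ℝ (G s) h) := by
    rw [he]; ring
  rw [h6]
  refine (abs_add_le _ _).trans ((add_le_add h1 h4).trans_eq (by ring))

theorem differentiable_optV (hC₁ : 0 < C₁) (hC₂ : 0 ≤ C₂) (s : S) :
    Differentiable ℝ fun θ => optV M (r θ) s := fun θ => by
  obtain ⟨G, -, h⟩ := exists_hasGradientAt_optV M hr hC₁ hC₂ θ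
  exact (h s).differentiableAt

theorem differentiable_optQ (hC₁ : 0 < C₁) (hC₂ : 0 ≤ C₂) (s : S) (a : A) :
    Differentiable ℝ fun θ => optQ M (r θ) s a := by
  intro θ
  obtain ⟨G, hG, h⟩ := exists_hasGradientAt_optV M hr hC₁ hC₂ θ
  have hγ : 0 < 1 - M.γ := by linarith [M.γ_lt_one]
  have hlip : ∀ s' (θ₁ θ₂ : Param d), |optV M (r θ₁) s' - optV M (r θ₂) s'|
      ≤ C₁ / (1 - M.γ) * ‖θ₁ - θ₂‖ := fun s' θ₁ θ₂ =>
    (abs_optV_sub_le M (hr.boundedMeasurable θ₂) (hr.boundedMeasurable θ₁)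
      (fun s a => hr.lipschitz θ₁ θ₂ s a) s').trans_eq (by ring)
  have h1 := hasFDerivAt_integral_of_dominated_loc_of_lip (𝕜 := ℝ) (μ := M.P (s, a))
    (F := fun θ s' => optV M (r θ) s') (x₀ := θ) (bound := fun _ => C₁ / (1 - M.γ))
    (F' := fun s' => InnerProductSpace.toDual ℝ (Param d) (G s')) (s := Set.univ) Filter.univ_mem
    (Eventually.of_forall fun θ =>
      (boundedMeasurable_optV M (hr.boundedMeasurable θ)).1.aestronglyMeasurable)
    ((boundedMeasurable_optV M (hr.boundedMeasurable θ)).integrable _)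
    ((InnerProductSpace.toDual ℝ (Param d)).continuous.comp_aestronglyMeasurable
      hG.1.aestronglyMeasurable)
    (Eventually.of_forall fun s' => by
      refine (LipschitzWith.of_dist_le_mul fun x y => ?_).lipschitzOnWith
      rw [Real.dist_eq, dist_eq_norm, Real.coe_nnabs]
      exact (hlip s' x y).trans (mul_le_mul_of_nonneg_right (le_abs_self _) (norm_nonneg _)))
    (integrable_const _)
    (Eventually.of_forall fun s' => (h s').hasFDerivAt)
  exact (hr.differentiable s a θ).add (h1.2.differentiableAt.const_mul M.γ)

theorem differentiable_log_optPolicy (hC₁ : 0 < C₁) (hC₂ : 0 ≤ C₂) (s : S) (a : A) :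
    Differentiable ℝ fun θ => Real.log (optPolicy M (r θ) s a) := by
  simp_rw [log_optPolicy]
  exact (differentiable_optQ M hr hC₁ hC₂ s a).sub (differentiable_optV M hr hC₁ hC₂ s)

theorem norm_gradient_log_optPolicy_le (hC₁ : 0 ≤ C₁) (s : S) (a : A) (θ : Param d) :
    ‖gradient (fun θ => Real.log (optPolicy M (r θ) s a)) θ‖ ≤ 2 * C₁ / (1 - M.γ) := by
  have hγ : 0 < 1 - M.γ := by linarith [M.γ_lt_one]
  refine norm_gradient_le_of_abs_sub_le (by positivity) (fun θ₁ θ₂ => ?_) θ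
  have hQ := abs_optQ_sub_le M (hr.boundedMeasurable θ₂) (hr.boundedMeasurable θ₁)
    (fun s a => hr.lipschitz θ₁ θ₂ s a) s a
  have hV := abs_optV_sub_le M (hr.boundedMeasurable θ₂) (hr.boundedMeasurable θ₁)
    (fun s a => hr.lipschitz θ₁ θ₂ s a) s
  rw [log_optPolicy, log_optPolicy, sub_sub_sub_comm]
  refine (abs_sub _ _).trans ((add_le_add hQ hV).trans_eq (by ring))

end Reward

/-! ### Soft optimality of the Bellman policy -/

section Optimality

variable (M : MDP S A) (π : Policy M)

theorem Policy.measurable_ofReal :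
    Measurable fun x : S × A => ENNReal.ofReal (π.density x.1 x.2) :=
  π.measurable.ennreal_ofReal

theorem lintegral_density_prod (ν : Measure S) [IsProbabilityMeasure ν] :
    ∫⁻ x, ENNReal.ofReal (π.density x.1 x.2) ∂(ν.prod M.volA) = 1 := by
  rw [lintegral_prod _ π.measurable_ofReal.aemeasurable]
  have h : ∀ s, ∫⁻ a, ENNReal.ofReal (π.density s a) ∂M.volA = 1 := fun s => by
    rw [← ofReal_integral_eq_lintegral_ofReal
      (integrable_of_integral_eq_one (π.integral_eq_one s))
      (Eventually.of_forall (π.nonneg s)), π.integral_eq_one, ENNReal.ofReal_one]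
  simp [h]

instance isProbabilityMeasure_saLaw (ν : Measure S) [IsProbabilityMeasure ν] :
    IsProbabilityMeasure (saLaw M ν π.density) :=
  ⟨by rw [saLaw, withDensity_apply _ MeasurableSet.univ, Measure.restrict_univ,
    lintegral_density_prod]⟩

instance isProbabilityMeasure_stateLaw (ν : Measure S) [IsProbabilityMeasure ν] (t : ℕ) :
    IsProbabilityMeasure (stateLaw M ν π.density t) := by
  induction t with
  | zero => assumption
  | succ t ih =>
    change IsProbabilityMeasure (M.P ∘ₘ saLaw M (stateLaw M ν π.density t) π.density)
    infer_instance

theorem integral_saLaw (ν : Measure S) (f : S × A → ℝ) :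
    ∫ x, f x ∂(saLaw M ν π.density) = ∫ x, π.density x.1 x.2 * f x ∂(ν.prod M.volA) := by
  rw [saLaw, integral_withDensity_eq_integral_toReal_smul π.measurable_ofReal
    (Eventually.of_forall fun _ => ENNReal.ofReal_lt_top)]
  simp_rw [ENNReal.toReal_ofReal (π.nonneg _ _), smul_eq_mul]

theorem integrable_saLaw_iff (ν : Measure S) (f : S × A → ℝ) :
    Integrable f (saLaw M ν π.density) ↔
      Integrable (fun x => π.density x.1 x.2 * f x) (ν.prod M.volA) := by
  rw [saLaw, integrable_withDensity_iff_integrable_smul' π.measurable_ofReal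
    (Eventually.of_forall fun _ => ENNReal.ofReal_lt_top)]
  simp_rw [ENNReal.toReal_ofReal (π.nonneg _ _), smul_eq_mul]

theorem integrable_density (ν : Measure S) [IsProbabilityMeasure ν] :
    Integrable (fun x => π.density x.1 x.2) (ν.prod M.volA) := by
  simpa using (integrable_saLaw_iff M π ν fun _ => 1).1 (integrable_const _)

theorem integral_saLaw_fst (ν : Measure S) [IsProbabilityMeasure ν] {f : S → ℝ}
    (hf : BoundedMeasurable f) : ∫ x, f x.1 ∂(saLaw M ν π.density) = ∫ s, f s ∂ν := by
  have hf' : BoundedMeasurable fun x : S × A => f x.1 :=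
    ⟨hf.1.comp measurable_fst, hf.2.imp fun _ h x => h x.1⟩
  rw [integral_saLaw, integral_prod _ ((integrable_saLaw_iff M π ν _).1 (hf'.integrable _))]
  refine integral_congr_ae (Eventually.of_forall fun s => ?_)
  simp only
  rw [integral_mul_const, π.integral_eq_one, one_mul]

theorem integral_stateLaw_succ (ν : Measure S) [IsProbabilityMeasure ν] (t : ℕ) {f : S → ℝ}
    (hf : BoundedMeasurable f) :
    ∫ s, f s ∂(stateLaw M ν π.density (t + 1))
      = ∫ x, ∫ s', f s' ∂(M.P x) ∂(saLaw M (stateLaw M ν π.density t) π.density) := by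
  have h := Kernel.integral_comp (η := M.P)
    (κ := Kernel.const Unit (saLaw M (stateLaw M ν π.density t) π.density)) (a := ()) (f := f)
    (by
      rw [← Measure.comp_eq_comp_const_apply]
      exact hf.integrable (stateLaw M ν π.density (t + 1)))
  rw [← Measure.comp_eq_comp_const_apply] at h
  exact h

/-- Gibbs' inequality: the relative entropy of the action density `π` with respect to another
action density `q` is nonnegative. -/
theorem integral_log_sub_log_nonpos (ν : Measure S) [IsProbabilityMeasure ν] (q : Policy M)
    (hq : ∀ s a, 0 < q.density s a)
    (hqi : Integrable (fun x => Real.log (q.density x.1 x.2)) (saLaw M ν π.density))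
    (hπi : Integrable (fun x => Real.log (π.density x.1 x.2)) (saLaw M ν π.density)) :
    ∫ x, (Real.log (q.density x.1 x.2) - Real.log (π.density x.1 x.2)) ∂(saLaw M ν π.density)
      ≤ 0 := by
  have hone : ∀ p : Policy M, ∫ x, p.density x.1 x.2 ∂(ν.prod M.volA) = 1 := fun p => by
    simpa using (integral_saLaw M p ν fun _ => 1).symm
  have hle : ∫ x, π.density x.1 x.2 *
      (Real.log (q.density x.1 x.2) - Real.log (π.density x.1 x.2)) ∂(ν.prod M.volA)
      ≤ ∫ x, (q.density x.1 x.2 - π.density x.1 x.2) ∂(ν.prod M.volA) := by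
    refine integral_mono ((integrable_saLaw_iff M π ν _).1 (hqi.sub hπi))
      ((integrable_density M q ν).sub (integrable_density M π ν)) fun x => ?_
    simp only
    rcases (π.nonneg x.1 x.2).eq_or_lt with h0 | h0
    -- where `π` vanishes, `log π` is the junk value `0`, but its weight is `0` as well
    · rw [← h0, zero_mul, sub_zero]
      exact (hq _ _).le
    · rw [← Real.log_div (hq _ _).ne' h0.ne']
      refine (mul_le_mul_of_nonneg_left (Real.log_le_sub_one_of_pos (div_pos (hq _ _) h0))
        h0.le).trans_eq ?_
      field_simp
  rw [integral_saLaw]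
  rwa [integral_sub (integrable_density M q ν) (integrable_density M π ν), hone, hone,
    sub_self] at hle

/-- Discounted sums of bounded sequences converge. -/
theorem MDP.summable_discounted {c : ℕ → ℝ} {K : ℝ} (h : ∀ t, |c t| ≤ K) :
    Summable fun t => M.γ ^ t * c t := by
  refine Summable.of_norm_bounded (g := fun t => M.γ ^ t * K)
    ((summable_geometric_of_lt_one M.γ_nonneg M.γ_lt_one).mul_right K) fun t => ?_
  rw [norm_mul, norm_pow, Real.norm_of_nonneg M.γ_nonneg]
  exact mul_le_mul_of_nonneg_left (h t) (pow_nonneg M.γ_nonneg t)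

variable {r : S → A → ℝ} (hr : BoundedMeasurable (Function.uncurry r))
include hr

/-- The soft Bellman policy, as a policy. -/
def bellmanPolicy : Policy M where
  density := optPolicy M r
  measurable := measurable_optPolicy M hr
  nonneg s a := (optPolicy_pos M r s a).le
  integral_eq_one := integral_optPolicy M hr

theorem boundedMeasurable_log_optPolicy :
    BoundedMeasurable fun x : S × A => Real.log (optPolicy M r x.1 x.2) := by
  obtain ⟨K, hK⟩ := (boundedMeasurable_optQ M hr).2
  obtain ⟨L, hL⟩ := (boundedMeasurable_optV M hr).2
  simp_rw [log_optPolicy]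
  exact ⟨(boundedMeasurable_optQ M hr).1.sub ((boundedMeasurable_optV M hr).1.comp measurable_fst),
    K + L, fun x => (norm_sub_le _ _).trans (add_le_add (hK x) (hL x.1))⟩

theorem finiteEntropy_optPolicy : FiniteEntropy M (optPolicy M r) := by
  have hb := boundedMeasurable_log_optPolicy M hr
  have hprob : ∀ t, IsProbabilityMeasure
      (saLaw M (stateLaw M M.P0 (optPolicy M r) t) (optPolicy M r)) := fun t =>
    isProbabilityMeasure_saLaw M (bellmanPolicy M hr)
      (stateLaw M M.P0 (bellmanPolicy M hr).density t)
  obtain ⟨K, hK⟩ := hb.2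
  refine ⟨fun t => hb.integrable _, M.summable_discounted (K := K) fun t => ?_⟩
  exact norm_integral_le_of_norm_le_prob (f := fun x : S × A => |Real.log (optPolicy M r x.1 x.2)|)
    fun x => by simpa using hK x

/-- Performance difference: the regularized value of a policy is the mean initial optimal value
minus the discounted relative entropies with respect to the Bellman policy. -/
theorem cumReward_add_causalEntropy (hπ : FiniteEntropy M π.density) :
    cumReward M r π.density + causalEntropy M π.density
      = ∫ s, optV M r s ∂M.P0 + ∑' t : ℕ, M.γ ^ t *
        ∫ x, (Real.log (optPolicy M r x.1 x.2) - Real.log (π.density x.1 x.2))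
          ∂(saLaw M (stateLaw M M.P0 π.density t) π.density) := by
  have hV := boundedMeasurable_optV M hr
  have hlog := boundedMeasurable_log_optPolicy M hr
  obtain ⟨K, hK⟩ := hV.2
  obtain ⟨R, hR⟩ := hr.2
  set σ : ℕ → Measure (S × A) := fun t => saLaw M (stateLaw M M.P0 π.density t) π.density with hσ
  have hprob : ∀ t, IsProbabilityMeasure (σ t) := fun t => isProbabilityMeasure_saLaw M π _
  set v : ℕ → ℝ := fun t => ∫ s, optV M r s ∂(stateLaw M M.P0 π.density t) with hv
  have hV1 : BoundedMeasurable fun x : S × A => optV M r x.1 :=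
    ⟨hV.1.comp measurable_fst, K, fun x => hK x.1⟩
  have hV2 : BoundedMeasurable fun x : S × A => ∫ s', optV M r s' ∂(M.P x) :=
    ⟨(StronglyMeasurable.integral_kernel hV.1.stronglyMeasurable).measurable, K,
      fun x => norm_integral_le_of_norm_le_prob hK⟩
  have hstep : ∀ t, ∫ x, r x.1 x.2 ∂(σ t) + ∫ x, -Real.log (π.density x.1 x.2) ∂(σ t)
      = v t - M.γ * v (t + 1)
        + ∫ x, (Real.log (optPolicy M r x.1 x.2) - Real.log (π.density x.1 x.2)) ∂(σ t) := by
    intro t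
    have h1 : ∫ x, r x.1 x.2 ∂(σ t)
        = ∫ x, (optV M r x.1 - M.γ * ∫ s', optV M r s' ∂(M.P x)
          + Real.log (optPolicy M r x.1 x.2)) ∂(σ t) := by
      -- `log π_θ = Q_θ - V_θ`, and `Q_θ` is the one-step look-ahead of `V_θ`
      refine integral_congr_ae (Eventually.of_forall fun x => ?_)
      simp only [log_optPolicy, optQ, lookahead]
      ring
    rw [h1, integral_add (f := fun x => optV M r x.1 - M.γ * ∫ s', optV M r s' ∂(M.P x))
        ((hV1.integrable _).sub ((hV2.integrable _).const_mul _)) (hlog.integrable _),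
      integral_sub (hV1.integrable _) ((hV2.integrable _).const_mul _), integral_const_mul,
      integral_neg, integral_sub (hlog.integrable _) (hπ.1 t),
      integral_saLaw_fst M π _ hV, ← integral_stateLaw_succ M π M.P0 t hV]
    ring
  have hsr : Summable fun t => M.γ ^ t * ∫ x, r x.1 x.2 ∂(σ t) :=
    M.summable_discounted (K := R) fun t => norm_integral_le_of_norm_le_prob hR
  have hsl : Summable fun t => M.γ ^ t * ∫ x, -Real.log (π.density x.1 x.2) ∂(σ t) := by
    refine Summable.of_norm_bounded hπ.2 fun t => ?_
    rw [norm_mul, norm_pow, Real.norm_of_nonneg M.γ_nonneg, integral_neg, norm_neg]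
    exact mul_le_mul_of_nonneg_left (norm_integral_le_integral_norm _) (pow_nonneg M.γ_nonneg t)
  have hsv : Summable fun t => M.γ ^ t * v t :=
    M.summable_discounted (K := K) fun t => norm_integral_le_of_norm_le_prob hK
  have hsv' : Summable fun t => M.γ ^ (t + 1) * v (t + 1) := (summable_nat_add_iff 1).2 hsv
  have hsum : ∀ t, M.γ ^ t * ∫ x, r x.1 x.2 ∂(σ t)
        + M.γ ^ t * ∫ x, -Real.log (π.density x.1 x.2) ∂(σ t)
      = M.γ ^ t * v t - M.γ ^ (t + 1) * v (t + 1) + M.γ ^ t *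
        ∫ x, (Real.log (optPolicy M r x.1 x.2) - Real.log (π.density x.1 x.2)) ∂(σ t) := by
    intro t
    rw [← mul_add, hstep t]
    ring
  have hsk : Summable fun t => M.γ ^ t *
      ∫ x, (Real.log (optPolicy M r x.1 x.2) - Real.log (π.density x.1 x.2)) ∂(σ t) := by
    refine ((hsr.add hsl).sub (hsv.sub hsv')).congr fun t => ?_
    rw [hsum t]
    ring
  have h0 : v 0 = ∫ s, optV M r s ∂M.P0 := rfl
  calc cumReward M r π.density + causalEntropy M π.density
      = ∑' t, (M.γ ^ t * v t - M.γ ^ (t + 1) * v (t + 1) + M.γ ^ t *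
          ∫ x, (Real.log (optPolicy M r x.1 x.2) - Real.log (π.density x.1 x.2)) ∂(σ t)) := by
        simp_rw [← hsum]
        exact (hsr.tsum_add hsl).symm
    _ = _ := by
        rw [(hsv.sub hsv').tsum_add hsk, hsv.tsum_sub hsv', hsv.tsum_eq_zero_add, ← h0]
        ring

theorem isSoftOptimal_optPolicy : IsSoftOptimal M r (optPolicy M r) := by
  have hfin := finiteEntropy_optPolicy M hr
  refine ⟨bellmanPolicy M hr, rfl, hfin, fun π hπ => ?_⟩
  have hopt := cumReward_add_causalEntropy M (bellmanPolicy M hr) hr hfin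
  simp only [bellmanPolicy, sub_self, integral_zero, mul_zero, tsum_zero, add_zero] at hopt
  rw [hopt, cumReward_add_causalEntropy M π hr hπ, add_le_iff_nonpos_right]
  refine tsum_nonpos fun t => mul_nonpos_of_nonneg_of_nonpos (pow_nonneg M.γ_nonneg t) ?_
  exact integral_log_sub_log_nonpos M π _ (bellmanPolicy M hr) (optPolicy_pos M r)
    ((boundedMeasurable_log_optPolicy M hr).integrable _) (hπ.1 t)

end Optimality

/-! ### The local regret -/

section Regret

variable (M : MDP S A) {r : Param d → S → A → ℝ} {C₁ C₂ : ℝ} (hr : RewardAssumption r C₁ C₂)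
  (lam : ℝ) (θbar : Param d)

section

include hr

theorem differentiable_loss (hC₁ : 0 < C₁) (hC₂ : 0 ≤ C₂) (t : ℕ) (x : S × A) :
    Differentiable ℝ (loss M r lam θbar t x) := by
  have h := differentiable_log_optPolicy M hr hC₁ hC₂ x.1 x.2
  have h2 : Differentiable ℝ fun θ : Param d => ‖θ - θbar‖ ^ 2 :=
    (differentiable_id.sub_const θbar).norm_sq ℝ
  exact (h.const_mul _).add (h2.const_mul _)

theorem gradient_loss (hC₁ : 0 < C₁) (hC₂ : 0 ≤ C₂) (t : ℕ) (x : S × A) (θ : Param d) :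
    gradient (loss M r lam θbar t x) θ
      = M.γ ^ t • (lam • (θ - θbar)
        - gradient (fun θ => Real.log (optPolicy M (r θ) x.1 x.2)) θ) := by
  have h := (differentiable_log_optPolicy M hr hC₁ hC₂ x.1 x.2 θ).hasGradientAt.hasFDerivAt
  have h2 : HasFDerivAt (fun θ : Param d => ‖θ - θbar‖ ^ 2) (2 • innerSL ℝ (θ - θbar)) θ :=
    ((hasFDerivAt_id θ).sub_const θbar).norm_sq
  have h3 := ((h.const_mul (-M.γ ^ t)).add (h2.const_mul (lam * M.γ ^ t / 2)))
  refine HasGradientAt.gradient ?_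
  rw [hasGradientAt_iff_hasFDerivAt]
  refine h3.congr_fderiv ?_
  ext y
  simp
  ring

theorem norm_gradient_loss_le (hC₁ : 0 < C₁) (hC₂ : 0 ≤ C₂) (hlam : 0 ≤ lam) (t : ℕ) (x : S × A)
    (θ : Param d) : ‖gradient (loss M r lam θbar t x) θ‖
      ≤ M.γ ^ t * (lam * ‖θ - θbar‖ + 2 * C₁ / (1 - M.γ)) := by
  rw [gradient_loss M hr lam θbar hC₁ hC₂, norm_smul, norm_pow, Real.norm_of_nonneg M.γ_nonneg]
  refine mul_le_mul_of_nonneg_left ?_ (pow_nonneg M.γ_nonneg t)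
  refine (norm_sub_le _ _).trans (add_le_add ?_
    (norm_gradient_log_optPolicy_le M hr hC₁.le x.1 x.2 θ))
  rw [norm_smul, Real.norm_of_nonneg hlam]

theorem norm_discounted_gradient_le (hC₁ : 0 ≤ C₁) (x : ℕ → S × A) (θ : Param d) :
    ‖∑' i : ℕ, M.γ ^ i • gradient (fun θ' => r θ' (x i).1 (x i).2) θ‖ ≤ C₁ / (1 - M.γ) := by
  have h := (hasSum_geometric_of_lt_one M.γ_nonneg M.γ_lt_one).mul_right C₁
  refine (tsum_of_norm_bounded h fun i => ?_).trans_eq (by ring)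
  rw [norm_smul, norm_pow, Real.norm_of_nonneg M.γ_nonneg]
  exact mul_le_mul_of_nonneg_left (hr.norm_gradient_le hC₁ _ _ _) (pow_nonneg M.γ_nonneg i)

/-- With `η_t = (t + 1)^(-1/2) (1 - γ^(t+1)) ∈ [0, 1]`, an update multiplies `θ_t - θbar` by
`1 - η_t` and adds a vector of norm at most `η_t R`, where `R` is the stated radius; so the
parameters never leave the ball of radius `R` around `θbar`. -/
theorem norm_thetaSeq_sub_le (hC₁ : 0 < C₁) (hlam : 0 < lam) (x₁ x₂ : ℕ → ℕ → S × A) (t : ℕ) :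
    ‖thetaSeq M r lam θbar x₁ x₂ t - θbar‖ ≤ 2 * C₁ / (lam * (1 - M.γ)) := by
  have hγ : 0 < 1 - M.γ := by linarith [M.γ_lt_one]
  induction t with
  | zero => simp only [thetaSeq, sub_self, norm_zero]; positivity
  | succ t ih =>
    set θ := thetaSeq M r lam θbar x₁ x₂ t with hθ
    set R := 2 * C₁ / (lam * (1 - M.γ)) with hR
    set η : ℝ := ((t : ℝ) + 1) ^ (-(1 / 2) : ℝ) with hη
    set b := (∑' i : ℕ, M.γ ^ i • gradient (fun θ' => r θ' (x₁ t i).1 (x₁ t i).2) θ)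
      - (∑' i : ℕ, M.γ ^ i • gradient (fun θ' => r θ' (x₂ t i).1 (x₂ t i).2) θ) with hb
    have hη0 : 0 ≤ η := by positivity
    have hη1 : η ≤ 1 := Real.rpow_le_one_of_one_le_of_nonpos (by linarith [t.cast_nonneg (α := ℝ)])
      (by norm_num)
    have hp0 : 0 ≤ M.γ ^ (t + 1) := pow_nonneg M.γ_nonneg _
    have hp1 : M.γ ^ (t + 1) ≤ M.γ := pow_le_of_le_one M.γ_nonneg M.γ_lt_one.le (by omega)
    have hbn : ‖b‖ ≤ 2 * C₁ / (1 - M.γ) := by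
      refine (norm_sub_le _ _).trans ((add_le_add (norm_discounted_gradient_le M hr hC₁.le _ _)
        (norm_discounted_gradient_le M hr hC₁.le _ _)).trans_eq (by ring))
    have hstep : thetaSeq M r lam θbar x₁ x₂ (t + 1) - θbar
        = (1 - η * (1 - M.γ ^ (t + 1))) • (θ - θbar) - ((1 - M.γ) * η / lam) • b := by
      have hc : (1 - M.γ) * η / lam * (lam * (1 - M.γ ^ (t + 1)) / (1 - M.γ))
          = η * (1 - M.γ ^ (t + 1)) := by field_simp
      simp only [thetaSeq, gradEst, stepSize, ← hθ, ← hη, ← hb]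
      rw [smul_add, smul_smul, hc]
      module
    have hw : 0 ≤ 1 - η * (1 - M.γ ^ (t + 1)) := by nlinarith
    rw [hstep]
    refine (norm_sub_le _ _).trans ?_
    rw [norm_smul, norm_smul, Real.norm_of_nonneg hw, Real.norm_of_nonneg (by positivity)]
    have h1 := mul_le_mul_of_nonneg_left ih hw
    have h2 : (1 - M.γ) * η / lam * ‖b‖ ≤ η * ((1 - M.γ) * R) := by
      refine (mul_le_mul_of_nonneg_left hbn (by positivity)).trans_eq ?_
      rw [hR]; field_simp
    have h3 : η * ((1 - M.γ) * R) ≤ η * ((1 - M.γ ^ (t + 1)) * R) := by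
      have : 0 ≤ R := by positivity
      gcongr
    linarith

theorem norm_sum_gradient_loss_le (hC₁ : 0 < C₁) (hC₂ : 0 ≤ C₂) (hlam : 0 ≤ lam)
    (e : ℕ → S × A) (θ : Param d) (n : ℕ) :
    ‖∑ i ∈ Finset.range n, gradient (loss M r lam θbar i (e i)) θ‖
      ≤ (lam * ‖θ - θbar‖ + 2 * C₁ / (1 - M.γ)) / (1 - M.γ) := by
  have hγ : 0 < 1 - M.γ := by linarith [M.γ_lt_one]
  refine (norm_sum_le_of_le _ fun i _ =>
    norm_gradient_loss_le M hr lam θbar hC₁ hC₂ hlam i (e i) θ).trans ?_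
  rw [← Finset.sum_mul, div_eq_inv_mul (lam * ‖θ - θbar‖ + 2 * C₁ / (1 - M.γ))]
  refine mul_le_mul_of_nonneg_right ?_ (by positivity)
  have h := Summable.sum_le_tsum (f := fun i => M.γ ^ i) (Finset.range n)
    (fun i _ => pow_nonneg M.γ_nonneg i) (summable_geometric_of_lt_one M.γ_nonneg M.γ_lt_one)
  rwa [tsum_geometric_of_lt_one M.γ_nonneg M.γ_lt_one] at h

/-- The summand of the local regret at time `t` is at most `D₁ / (t + 1)` on every trajectory. -/
theorem localRegret_summand_le (hC₁ : 0 < C₁) (hC₂ : 0 ≤ C₂) (hlam : 0 < lam)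
    (e : ℕ → S × A) (x₁ x₂ : ℕ → ℕ → S × A) (t : ℕ) :
    ‖(1 / ((t : ℝ) + 1)) • ∑ i ∈ Finset.range (t + 1),
        gradient (loss M r lam θbar i (e i)) (thetaSeq M r lam θbar x₁ x₂ t)‖ ^ 2
      ≤ constD₁ M.γ C₁ * (1 / ((t : ℝ) + 1)) := by
  have hγ : 0 < 1 - M.γ := by linarith [M.γ_lt_one]
  set θ := thetaSeq M r lam θbar x₁ x₂ t with hθ
  set N := ‖∑ i ∈ Finset.range (t + 1), gradient (loss M r lam θbar i (e i)) θ‖ with hN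
  have hsum : N ≤ _ := norm_sum_gradient_loss_le M hr lam θbar hC₁ hC₂ hlam.le e θ (t + 1)
  have hN0 : 0 ≤ N := norm_nonneg _
  have hD : 8 * C₁ ^ 2 / (1 - M.γ) ^ 4 ≤ constD₁ M.γ C₁ := by
    refine div_le_div_of_nonneg_right (le_mul_of_one_le_right (by positivity) ?_) (by positivity)
    exact one_le_pow₀ (by linarith)
  have hn : (1 : ℝ) ≤ (t : ℝ) + 1 := by linarith [t.cast_nonneg (α := ℝ)]
  -- at time `0` the regularizer vanishes; from time `1` on, one factor `1 / (t + 1)` is at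
  -- most `1 / 2`
  have hN2 : N ^ 2 ≤ 8 * C₁ ^ 2 / (1 - M.γ) ^ 4 * (t + 1) := by
    rcases Nat.eq_zero_or_pos t with h0 | h0
    · have hz : θ - θbar = 0 := by simp [hθ, h0, thetaSeq]
      rw [hz, norm_zero, mul_zero, zero_add] at hsum
      have h1 : N ^ 2 ≤ (2 * C₁ / (1 - M.γ) / (1 - M.γ)) ^ 2 := pow_le_pow_left₀ hN0 hsum 2
      have h2 : (2 * C₁ / (1 - M.γ) / (1 - M.γ)) ^ 2
          = 4 * (C₁ ^ 2 / (1 - M.γ) ^ 4) := by field_simp; ring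
      have h3 : 0 ≤ C₁ ^ 2 / (1 - M.γ) ^ 4 := by positivity
      rw [mul_div_assoc]
      nlinarith
    · have h1 := norm_thetaSeq_sub_le M hr lam θbar hC₁ hlam x₁ x₂ t
      have h2 : N ≤ 4 * C₁ / (1 - M.γ) ^ 2 := by
        refine hsum.trans ?_
        have : lam * ‖θ - θbar‖ ≤ 2 * C₁ / (1 - M.γ) := by
          refine (mul_le_mul_of_nonneg_left h1 hlam.le).trans_eq ?_
          field_simp
        refine (div_le_div_of_nonneg_right (add_le_add_left this _) hγ.le).trans_eq ?_
        field_simp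
        ring
      have h3 : N ^ 2 ≤ (4 * C₁ / (1 - M.γ) ^ 2) ^ 2 := pow_le_pow_left₀ hN0 h2 2
      have h4 : (4 * C₁ / (1 - M.γ) ^ 2) ^ 2 = 16 * (C₁ ^ 2 / (1 - M.γ) ^ 4) := by
        field_simp; ring
      have h5 : 0 ≤ C₁ ^ 2 / (1 - M.γ) ^ 4 := by positivity
      have h6 : (1 : ℝ) ≤ t := by exact_mod_cast h0
      rw [mul_div_assoc]
      nlinarith
  rw [norm_smul, Real.norm_of_nonneg (by positivity), ← hN, mul_pow]
  calc (1 / ((t : ℝ) + 1)) ^ 2 * N ^ 2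
      ≤ (1 / ((t : ℝ) + 1)) ^ 2 * (8 * C₁ ^ 2 / (1 - M.γ) ^ 4 * (t + 1)) := by gcongr
    _ = 8 * C₁ ^ 2 / (1 - M.γ) ^ 4 * (1 / ((t : ℝ) + 1)) := by field_simp
    _ ≤ _ := by gcongr

theorem localRegret_le (hC₁ : 0 < C₁) (hC₂ : 0 ≤ C₂) (hlam : 0 < lam)
    (e : ℕ → S × A) (x₁ x₂ : ℕ → ℕ → S × A) (T : ℕ) :
    localRegret M r lam θbar e (thetaSeq M r lam θbar x₁ x₂) T
      ≤ constD₁ M.γ C₁ * (Real.log T + 1) := by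
  have hD : 0 ≤ constD₁ M.γ C₁ := by
    have hγ : 0 < 1 - M.γ := by linarith [M.γ_lt_one]
    unfold constD₁; positivity
  refine (Finset.sum_le_sum fun t _ =>
    localRegret_summand_le M hr lam θbar hC₁ hC₂ hlam e x₁ x₂ t).trans ?_
  rw [← Finset.mul_sum]
  refine mul_le_mul_of_nonneg_left ?_ hD
  have h := harmonic_le_one_add_log T
  simp only [harmonic, Rat.cast_sum, Rat.cast_inv, Rat.cast_natCast, Nat.cast_add, Nat.cast_one,
    Rat.cast_add, Rat.cast_one] at h
  simp_rw [one_div]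
  linarith

theorem measurable_gradient_loss (hC₁ : 0 < C₁) (hC₂ : 0 ≤ C₂) (t : ℕ) :
    Measurable fun p : (S × A) × Param d => gradient (loss M r lam θbar t p.1) p.2 :=
  measurable_gradient_uncurry (fun θ =>
    ((boundedMeasurable_log_optPolicy M (hr.boundedMeasurable θ)).1.const_mul _).add_const _)
    fun x => differentiable_loss M hr lam θbar hC₁ hC₂ t x

variable {Ω : Type*} [MeasurableSpace Ω]

theorem measurable_thetaSeq {X₁ X₂ : ℕ → ℕ → Ω → S × A} (h₁ : ∀ t i, Measurable (X₁ t i))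
    (h₂ : ∀ t i, Measurable (X₂ t i)) (t : ℕ) :
    Measurable fun ω => thetaSeq M r lam θbar (fun t i => X₁ t i ω) (fun t i => X₂ t i ω) t := by
  induction t with
  | zero => exact measurable_const
  | succ t ih =>
    have hsum : ∀ {X : ℕ → Ω → S × A}, (∀ i, Measurable (X i)) → Measurable fun ω =>
        ∑' i : ℕ, M.γ ^ i • gradient (fun θ' => r θ' (X i ω).1 (X i ω).2)
          (thetaSeq M r lam θbar (fun t i => X₁ t i ω) (fun t i => X₂ t i ω) t) := by
      intro X hX
      refine Measurable.tsum fun i => Measurable.const_smul ?_ (M.γ ^ i)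
      exact hr.measurable_gradient.comp ((hX i).prodMk ih)
    have hg := ((hsum (h₁ t)).sub (hsum (h₂ t))).add
      ((ih.sub_const θbar).const_smul (lam * (1 - M.γ ^ (t + 1)) / (1 - M.γ)))
    exact ih.sub (hg.const_smul (stepSize M lam t))

theorem measurable_localRegret (hC₁ : 0 < C₁) (hC₂ : 0 ≤ C₂) {E : ℕ → Ω → S × A}
    {θ : ℕ → Ω → Param d} (hE : ∀ i, Measurable (E i)) (hθ : ∀ t, Measurable (θ t)) (T : ℕ) :
    Measurable fun ω => localRegret M r lam θbar (fun i => E i ω) (fun t => θ t ω) T := by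
  have hgrad : ∀ t i, Measurable fun ω => gradient (loss M r lam θbar i (E i ω)) (θ t ω) := by
    intro t i
    have h := measurable_gradient_loss M hr lam θbar hC₁ hC₂ i
    generalize loss M r lam θbar i = f at h ⊢
    exact h.comp ((hE i).prodMk (hθ t))
  unfold localRegret
  refine Finset.measurable_sum _ fun t _ => ?_
  have h := (Finset.measurable_sum (Finset.range (t + 1)) fun i _ => hgrad t i).const_smul
    (1 / ((t : ℝ) + 1))
  exact h.norm.pow_const 2

end

theorem localRegret_nonneg (e : ℕ → S × A) (θ : ℕ → Param d) (T : ℕ) :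
    0 ≤ localRegret M r lam θbar e θ T :=
  Finset.sum_nonneg fun _ _ => sq_nonneg _

theorem constD₃_nonneg (hC₁ : 0 ≤ C₁) (hC₂ : 0 ≤ C₂) (hlam : 0 ≤ lam) :
    0 ≤ constD₃ M C₁ C₂ lam := by
  have hγ : 0 < 1 - M.γ := by linarith [M.γ_lt_one]
  unfold constD₃ constQ constd constL
  positivity

end Regret

end

end MeritIRL

theorem theorem1 {S A : Type*} [MeasurableSpace S] [MeasurableSpace A] {d : ℕ}
    (M : MeritIRL.MDP S A)
    (r : MeritIRL.Param d → S → A → ℝ) (C₁ C₂ : ℝ) (hC₁ : 0 < C₁) (hC₂ : 0 < C₂)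
    (hr : MeritIRL.RewardAssumption r C₁ C₂)
    (CM ρ : ℝ) (hCM : 0 < CM) (hρ0 : 0 < ρ) (hρ1 : ρ < 1) (hM : MeritIRL.Ergodic M CM ρ)
    (lam : ℝ) (hlam : 0 < lam) (θbar : MeritIRL.Param d) (πE π₀ : MeritIRL.Policy M)
    {Ω : Type*} [MeasurableSpace Ω] (μ : Measure Ω) [IsProbabilityMeasure μ]
    (E : ℕ → Ω → S × A) (X₁ X₂ : ℕ → ℕ → Ω → S × A)
    (hrun : MeritIRL.IsRun M r lam θbar πE π₀ μ E X₁ X₂) (D₂ : ℝ) (hD₂ : 0 < D₂) :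
    (∀ θ, MeritIRL.IsSoftOptimal M (r θ) (MeritIRL.optPolicy M (r θ))) ∧
    (∀ t x, Differentiable ℝ (MeritIRL.loss M r lam θbar t x)) ∧
    ∀ T : ℕ, 1 ≤ T →
      Integrable (fun ω => MeritIRL.localRegret M r lam θbar (fun i => E i ω)
        (MeritIRL.thetaSeq M r lam θbar (fun t i => X₁ t i ω) (fun t i => X₂ t i ω)) T) μ ∧
      ∫ ω, MeritIRL.localRegret M r lam θbar (fun i => E i ω)
        (MeritIRL.thetaSeq M r lam θbar (fun t i => X₁ t i ω) (fun t i => X₂ t i ω)) T ∂μ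
        ≤ (MeritIRL.constD₁ M.γ C₁
            + 8 * CM * C₁ ^ 2 * (2 - M.γ) ^ 2 / ((1 - ρ * M.γ ^ 2) * (1 - M.γ) ^ 2))
              * (Real.log T + 1)
          + D₂ * √(T : ℝ)
          + MeritIRL.constD₃ M C₁ C₂ lam * √(T : ℝ) * (Real.log T + 1) := by
  refine ⟨fun θ => MeritIRL.isSoftOptimal_optPolicy M (hr.boundedMeasurable θ),
    MeritIRL.differentiable_loss M hr lam θbar hC₁ hC₂.le, fun T hT => ?_⟩
  set R : Ω → ℝ := fun ω => MeritIRL.localRegret M r lam θbar (fun i => E i ω)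
    (MeritIRL.thetaSeq M r lam θbar (fun t i => X₁ t i ω) (fun t i => X₂ t i ω)) T with hR
  have hle : ∀ ω, R ω ≤ MeritIRL.constD₁ M.γ C₁ * (Real.log T + 1) := fun ω =>
    MeritIRL.localRegret_le M hr lam θbar hC₁ hC₂.le hlam _ _ _ T
  have hRm : Measurable R := MeritIRL.measurable_localRegret M hr lam θbar hC₁ hC₂.le
    hrun.measurable_expert (MeritIRL.measurable_thetaSeq M hr lam θbar hrun.measurable_rollout₁
      hrun.measurable_rollout₂) T
  have hRi : Integrable R μ := by
    refine Integrable.of_bound hRm.aestronglyMeasurable (MeritIRL.constD₁ M.γ C₁ * (Real.log T + 1))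
      (Eventually.of_forall fun ω => ?_)
    rw [Real.norm_of_nonneg (MeritIRL.localRegret_nonneg M lam θbar _ _ T)]
    exact hle ω
  refine ⟨hRi, ?_⟩
  have hint : ∫ ω, R ω ∂μ ≤ MeritIRL.constD₁ M.γ C₁ * (Real.log T + 1) := by
    simpa using integral_mono hRi (integrable_const _) hle
  have hlog : 0 ≤ Real.log T := Real.log_natCast_nonneg T
  have hD₃ := MeritIRL.constD₃_nonneg M lam hC₁.le hC₂.le hlam.le
  have hργ : 0 < 1 - ρ * M.γ ^ 2 := by
    have : M.γ ^ 2 ≤ 1 := pow_le_one₀ M.γ_nonneg M.γ_lt_one.le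
    nlinarith
  have hmix : 0 ≤ 8 * CM * C₁ ^ 2 * (2 - M.γ) ^ 2 / ((1 - ρ * M.γ ^ 2) * (1 - M.γ) ^ 2) := by
    positivity
  have h₁ := mul_nonneg hmix (add_nonneg hlog zero_le_one)
  have h₂ := mul_nonneg hD₂.le (Real.sqrt_nonneg T)
  have h₃ := mul_nonneg (mul_nonneg hD₃ (Real.sqrt_nonneg T)) (add_nonneg hlog zero_le_one)
  rw [add_mul]
  linarith
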